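/- Let $n\ge 0$, $a=\xi_0<\xi_1<\dots<\xi_n<\xi_{n+1}=b$, $\Omega_k=(\xi_{k-1},\xi_k)$ for $k=1,\dots,n+1$, and let $\rho_k\in\mathbb R\setminus\{0\}$. Let $q$ be a real-valued function that is continuous on each $\Omega_k$ and has finite one-sided limits at the end points of each $\Omega_k$. Let $\delta_j,\gamma_j$ ($j=1,\dots,4$) and $\delta^{\pm}_{ij},\gamma^{\pm}_{ij}$ ($i=1,\dots,n$, $j=0,1$) be real numbers. Put $$\ell f=-\rho_k^2 f''+qf\ \text{ on }\Omega_k,\qquad \kappa_1=\begin{vmatrix}\delta_3&\delta_4\\ \delta_1&\delta_2\end{vmatrix},\qquad \kappa_2=\begin{vmatrix}\gamma_3&\gamma_4\\ \gamma_1&\gamma_2\end{vmatrix},$$ and let $\theta_{ijk}$ ($1\le j<k\le4$) be the determinant of the $j$-th and $k$-th columns of $$\begin{pmatrix}\delta^+_{i1}&\delta^+_{i0}&\delta^-_{i1}&\delta^-_{i0}\\ \gamma^+_{i1}&\gamma^+_{i0}&\gamma^-_{i1}&\gamma^-_{i0}\end{pmatrix}.$$ Assume $\kappa_1>0$, $\kappa_2>0$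 and $\theta_{ijk}>0$ for all $i$ and all $j<k$. Let $\mathcal H=\bigoplus_{k=1}^{n+1}L_2(\Omega_k)\oplus\mathbb C^2$, with the inner product of $F=(f,f_1,f_2)$ and $G=(g,g_1,g_2)$ given by $$\langle F,G\rangle=\sum_{k=0}^{n}\frac1{\rho_{k+1}^2}\prod_{i=1}^{k}\theta_{i12}\prod_{i=k+1}^{n}\theta_{i34}\int_{\xi_k}^{\xi_{k+1}}f\overline g\,dx+\prod_{i=1}^n\theta_{i34}\,\frac{f_1\overline{g_1}}{\kappa_1}+\prod_{i=1}^n\theta_{i12}\,\frac{f_2\overline{g_2}}{\kappa_2}.$$ Put $B_a[f]=\delta_1f(a)-\delta_2f'(a)$, $B_a'[f]=\delta_3f(a)-\delta_4f'(a)$, $B_b[f]=\gamma_1f(b)-\gamma_2f'(b)$, $B_b'[f]=\gamma_3f(b)-\gamma_4f'(b)$, where the values at $a$ and $b$ are one-sided limits. Let $\mathfrak R$ be the operator in $\mathcal H$ whose domain consists of all $F=(f,B_a'[f],-B_b'[f])$ such that $f$ and $f'$ are locally absolutely continuous on each $\Omega_k$ and have finite one-sided limits at the end points of each $\Omega_k$,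 $\ell f\in L_2(\Omega_k)$ for each $k$, and, for $i=1,\dots,n$, $$\delta^-_{i1}f'(\xi_i-)+\delta^-_{i0}f(\xi_i-)+\delta^+_{i1}f'(\xi_i+)+\delta^+_{i0}f(\xi_i+)=0,$$ $$\gamma^-_{i1}f'(\xi_i-)+\gamma^-_{i0}f(\xi_i-)+\gamma^+_{i1}f'(\xi_i+)+\gamma^+_{i0}f(\xi_i+)=0,$$ and whose action is $$\mathfrak R\,(f,B_a'[f],-B_b'[f])=(\ell f,B_a[f],B_b[f]).$$ Let $\sigma_p(\mathfrak R)\subseteq\mathbb C$ be the set of eigenvalues of $\mathfrak R$, and let $\sigma(\mathfrak R)$ be its spectrum, that is, the set of all $\lambda\in\mathbb C$ for which $\lambda I-\mathfrak R:\operatorname{dom}(\mathfrak R)\to\mathcal H$ has no everywhere defined bounded inverse. **Theorem.** The operator $\mathfrak R$ has only point spectrum, i.e. $\sigma(\mathfrak R)=\sigma_p(\mathfrak R)$. -/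

import Mathlib

open MeasureTheory Filter Topology Set
open scoped ENNReal ComplexConjugate

noncomputable section

/-! ### Spectrum of an unbounded operator -/

namespace UnboundedOperator

variable {E : Type*} [NormedAddCommGroup E] [NormedSpace ℂ E]

/-- The resolvent set of an unbounded operator `T`: all `z` such that `z - T : dom T → E` has an
everywhere defined bounded (two-sided) inverse. -/
def resolventSet (T : E →ₗ.[ℂ] E) : Set ℂ :=
  {z | ∃ S : E →L[ℂ] E,
    (∀ y : E, ∃ h : S y ∈ T.domain, z • S y - T ⟨S y, h⟩ = y) ∧
    (∀ x : T.domain, S (z • (x : E) - T x) = x)}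

/-- The spectrum: the complement of the resolvent set. -/
def spectrum (T : E →ₗ.[ℂ] E) : Set ℂ := (resolventSet T)ᶜ

/-- The point spectrum: the set of eigenvalues. -/
def pointSpectrum (T : E →ₗ.[ℂ] E) : Set ℂ :=
  {z | ∃ x : T.domain, (x : E) ≠ 0 ∧ T x = z • (x : E)}

end UnboundedOperator

/-! ### The boundary value transmission problem -/

namespace SturmTransmission

/-- The raw data of the problem: nodes `ξ 0 = a < ξ 1 < ⋯ < ξ (n+1) = b`, the numbers `ρ`, the
potential `q`, and the coefficients of the boundary and of the transmission conditions.
Interval number `k : Fin (n+1)` is `(ξ k, ξ (k+1))`; the transmission conditions are numbered by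
`i : Fin n`, number `i` being imposed at the interior node `ξ (i+1)`. In `δm i j`, `δp i j`,
`γm i j`, `γp i j` the index `j : Fin 2` is the order of the derivative, and `m`, `p` stand for
the left-hand (`-`) and right-hand (`+`) limit. -/
structure Coeffs (n : ℕ) where
  ξ : Fin (n + 2) → ℝ
  ρ : Fin (n + 1) → ℝ
  q : ℝ → ℝ
  δ₁ : ℝ
  δ₂ : ℝ
  δ₃ : ℝ
  δ₄ : ℝ
  γ₁ : ℝ
  γ₂ : ℝ
  γ₃ : ℝ
  γ₄ : ℝ
  δm : Fin n → Fin 2 → ℝ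
  δp : Fin n → Fin 2 → ℝ
  γm : Fin n → Fin 2 → ℝ
  γp : Fin n → Fin 2 → ℝ

namespace Coeffs

variable {n : ℕ} (c : Coeffs n)

/-- The left end point of interval number `k`. -/
def lo (k : Fin (n + 1)) : ℝ := c.ξ k.castSucc

/-- The right end point of interval number `k`. -/
def hi (k : Fin (n + 1)) : ℝ := c.ξ k.succ

/-- Interval number `k`. -/
def Ω (k : Fin (n + 1)) : Set ℝ := Ioo (c.lo k) (c.hi k)

/-- The coefficient matrix of the two transmission conditions number `i`. -/
def transMatrix (i : Fin n) : Matrix (Fin 2) (Fin 4) ℝ :=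
  !![c.δp i 1, c.δp i 0, c.δm i 1, c.δm i 0;
     c.γp i 1, c.γp i 0, c.γm i 1, c.γm i 0]

/-- The minor of `transMatrix i` formed by the columns `j` and `k` (counted from `0`). -/
def θ (i : Fin n) (j k : Fin 4) : ℝ :=
  ((c.transMatrix i).submatrix id ![j, k]).det

def κ₁ : ℝ := !![c.δ₃, c.δ₄; c.δ₁, c.δ₂].det

def κ₂ : ℝ := !![c.γ₃, c.γ₄; c.γ₁, c.γ₂].det

end Coeffs

/-- Data satisfying the standing assumptions. -/
structure Problem (n : ℕ) extends Coeffs n where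
  ξ_strictMono : StrictMono ξ
  ρ_ne_zero : ∀ k, ρ k ≠ 0
  q_continuousOn : ∀ k, ContinuousOn q (toCoeffs.Ω k)
  q_limit_lo : ∀ k, ∃ l, Tendsto q (𝓝[>] (toCoeffs.lo k)) (𝓝 l)
  q_limit_hi : ∀ k, ∃ l, Tendsto q (𝓝[<] (toCoeffs.hi k)) (𝓝 l)
  θ_pos : ∀ i j k, j < k → 0 < toCoeffs.θ i j k
  κ₁_pos : 0 < toCoeffs.κ₁
  κ₂_pos : 0 < toCoeffs.κ₂

namespace Problem

variable {n : ℕ} (P : Problem n)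

/-! ### The Hilbert space -/

/-- The direct sum of the `L²` spaces of the `n + 1` intervals and of `ℂ²`. -/
def Space : Type :=
  (∀ k : Fin (n + 1), Lp ℂ 2 (volume.restrict (P.Ω k))) × ℂ × ℂ

instance : AddCommGroup P.Space :=
  inferInstanceAs (AddCommGroup ((∀ k : Fin (n + 1), Lp ℂ 2 (volume.restrict (P.Ω k))) × ℂ × ℂ))

instance : Module ℂ P.Space :=
  inferInstanceAs (Module ℂ ((∀ k : Fin (n + 1), Lp ℂ 2 (volume.restrict (P.Ω k))) × ℂ × ℂ))

/-- The weight of interval number `k`: with the interior nodes numbered `1, …, n`, it is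
`ρ⁻²` times the product of the `θ₁₂` of the nodes to the left of the interval and of the `θ₃₄`
of the nodes to its right. -/
def weight (k : Fin (n + 1)) : ℝ :=
  1 / P.ρ k ^ 2 * (∏ i : Fin n, if (i : ℕ) < k then P.θ i 0 1 else P.θ i 2 3)

/-- The weight of the first complex coordinate. -/
def weight₁ : ℝ := (∏ i : Fin n, P.θ i 2 3) / P.κ₁

/-- The weight of the second complex coordinate. -/
def weight₂ : ℝ := (∏ i : Fin n, P.θ i 0 1) / P.κ₂

theorem weight_pos (k : Fin (n + 1)) : 0 < P.weight k := by
  have := P.ρ_ne_zero k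
  refine mul_pos (by positivity) (Finset.prod_pos fun i _ => ?_)
  split_ifs
  · exact P.θ_pos i 0 1 (by decide)
  · exact P.θ_pos i 2 3 (by decide)

theorem weight₁_pos : 0 < P.weight₁ :=
  div_pos (Finset.prod_pos fun i _ => P.θ_pos i 2 3 (by decide)) P.κ₁_pos

theorem weight₂_pos : 0 < P.weight₂ :=
  div_pos (Finset.prod_pos fun i _ => P.θ_pos i 0 1 (by decide)) P.κ₂_pos

/-- The weighted inner product, conjugate linear in the first argument as always in Mathlib
(so it is `⟨G, F⟩` in the convention where the second argument is conjugated). -/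
def innerProd (F G : P.Space) : ℂ :=
  (∑ k, (P.weight k : ℂ) * ∫ x in P.Ω k, G.1 k x * conj (F.1 k x)) +
    (P.weight₁ : ℂ) * (G.2.1 * conj F.2.1) + (P.weight₂ : ℂ) * (G.2.2 * conj F.2.2)

theorem innerProd_eq (F G : P.Space) :
    P.innerProd F G = (∑ k, (P.weight k : ℂ) * inner ℂ (F.1 k) (G.1 k)) +
      (P.weight₁ : ℂ) * inner ℂ F.2.1 G.2.1 + (P.weight₂ : ℂ) * inner ℂ F.2.2 G.2.2 := by
  simp [innerProd, L2.inner_def]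

theorem innerProd_self (F : P.Space) :
    P.innerProd F F = (((∑ k, P.weight k * ‖F.1 k‖ ^ 2) +
      P.weight₁ * ‖F.2.1‖ ^ 2 + P.weight₂ * ‖F.2.2‖ ^ 2 : ℝ) : ℂ) := by
  rw [innerProd_eq]
  simp only [inner_self_eq_norm_sq_to_K]
  push_cast
  rfl

/-- The weighted inner product satisfies the axioms. -/
@[reducible] def core : InnerProductSpace.Core ℂ P.Space where
  inner := P.innerProd
  conj_inner_symm F G := by
    simp only [innerProd_eq, map_add, map_sum, map_mul, Complex.conj_ofReal, inner_conj_symm]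
  re_inner_nonneg F := by
    rw [innerProd_self]
    have h1 := P.weight₁_pos
    have h2 := P.weight₂_pos
    have h3 : 0 ≤ ∑ k, P.weight k * ‖F.1 k‖ ^ 2 :=
      Finset.sum_nonneg fun k _ => mul_nonneg (P.weight_pos k).le (sq_nonneg _)
    rw [RCLike.re_eq_complex_re, Complex.ofReal_re]
    positivity
  add_left F G K := by
    have e0 : ∀ k, (F + G).1 k = F.1 k + G.1 k := fun _ => rfl
    have e1 : (F + G).2.1 = F.2.1 + G.2.1 := rfl
    have e2 : (F + G).2.2 = F.2.2 + G.2.2 := rfl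
    simp only [innerProd_eq, e0, e1, e2, inner_add_left, mul_add, Finset.sum_add_distrib]
    ring
  smul_left F G r := by
    have e0 : ∀ k, (r • F).1 k = r • F.1 k := fun _ => rfl
    have e1 : (r • F).2.1 = r • F.2.1 := rfl
    have e2 : (r • F).2.2 = r • F.2.2 := rfl
    simp only [innerProd_eq, e0, e1, e2, inner_smul_left, mul_add, Finset.mul_sum]
    congr 1
    · congr 1
      · exact Finset.sum_congr rfl fun k _ => by ring
      · ring
    · ring
  definite F h := by
    rw [innerProd_self, Complex.ofReal_eq_zero] at h
    have h1 := P.weight₁_pos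
    have h2 := P.weight₂_pos
    have p0 : ∀ k ∈ Finset.univ, 0 ≤ P.weight k * ‖F.1 k‖ ^ 2 :=
      fun k _ => mul_nonneg (P.weight_pos k).le (sq_nonneg _)
    have h3 := Finset.sum_nonneg p0
    have p1 : 0 ≤ P.weight₁ * ‖F.2.1‖ ^ 2 := by positivity
    have p2 : 0 ≤ P.weight₂ * ‖F.2.2‖ ^ 2 := by positivity
    have q0 : ∑ k, P.weight k * ‖F.1 k‖ ^ 2 = 0 := by linarith
    have q1 : P.weight₁ * ‖F.2.1‖ ^ 2 = 0 := by linarith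
    have q2 : P.weight₂ * ‖F.2.2‖ ^ 2 = 0 := by linarith
    have r1 : F.2.1 = 0 := by simpa [h1.ne'] using q1
    have r2 : F.2.2 = 0 := by simpa [h2.ne'] using q2
    have r0 : F.1 = 0 := by
      funext k
      have := (Finset.sum_eq_zero_iff_of_nonneg p0).1 q0 k (Finset.mem_univ k)
      have hk := (P.weight_pos k).ne'
      have : ‖F.1 k‖ ^ 2 = 0 := by simpa [hk] using this
      exact norm_eq_zero.1 (by simpa using this)
    exact Prod.ext r0 (Prod.ext r1 r2)

instance : NormedAddCommGroup P.Space :=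
  @InnerProductSpace.Core.toNormedAddCommGroup ℂ P.Space _ _ _ P.core

instance : InnerProductSpace ℂ P.Space :=
  InnerProductSpace.ofCore P.core.toCore

/-! ### Functions on the intervals and their boundary values

A function on `⋃ k, Ω k` is given as a family `u : Fin (n + 1) → ℝ → ℂ`; of `u k` only the values
on `Ω k` matter. -/

/-- `g(ξ+)` at the left end point `ξ` of interval number `k`. -/
def limLo (k : Fin (n + 1)) (g : ℝ → ℂ) : ℂ := limUnder (𝓝[>] (P.lo k)) g

/-- `g(ξ-)` at the right end point `ξ` of interval number `k`. -/
def limHi (k : Fin (n + 1)) (g : ℝ → ℂ) : ℂ := limUnder (𝓝[<] (P.hi k)) g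

/-- Local absolute continuity on interval number `k`. -/
def ACloc (k : Fin (n + 1)) (g : ℝ → ℂ) : Prop :=
  ∀ s t, s ≤ t → Icc s t ⊆ P.Ω k → AbsolutelyContinuousOnInterval g s t

/-- The differential expression `-ρ u'' + q u` on interval number `k`, where `ρ = ρₖ²`. -/
def ell (u : Fin (n + 1) → ℝ → ℂ) (k : Fin (n + 1)) (x : ℝ) : ℂ :=
  -((P.ρ k ^ 2 : ℝ) : ℂ) * deriv (deriv (u k)) x + (P.q x : ℂ) * u k x

/-- `δ₁ u(a) - δ₂ u'(a)` -/
def Ba (u : Fin (n + 1) → ℝ → ℂ) : ℂ :=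
  (P.δ₁ : ℂ) * P.limLo 0 (u 0) - (P.δ₂ : ℂ) * P.limLo 0 (deriv (u 0))

/-- `δ₃ u(a) - δ₄ u'(a)` -/
def Ba' (u : Fin (n + 1) → ℝ → ℂ) : ℂ :=
  (P.δ₃ : ℂ) * P.limLo 0 (u 0) - (P.δ₄ : ℂ) * P.limLo 0 (deriv (u 0))

/-- `γ₁ u(b) - γ₂ u'(b)` -/
def Bb (u : Fin (n + 1) → ℝ → ℂ) : ℂ :=
  (P.γ₁ : ℂ) * P.limHi (Fin.last n) (u (Fin.last n)) -
    (P.γ₂ : ℂ) * P.limHi (Fin.last n) (deriv (u (Fin.last n)))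

/-- `γ₃ u(b) - γ₄ u'(b)` -/
def Bb' (u : Fin (n + 1) → ℝ → ℂ) : ℂ :=
  (P.γ₃ : ℂ) * P.limHi (Fin.last n) (u (Fin.last n)) -
    (P.γ₄ : ℂ) * P.limHi (Fin.last n) (deriv (u (Fin.last n)))

/-- A general transmission functional at interior node number `i`, where interval `i.castSucc`
ends and interval `i.succ` begins. -/
def trans (m p : Fin n → Fin 2 → ℝ) (i : Fin n) (u : Fin (n + 1) → ℝ → ℂ) : ℂ :=
  (m i 1 : ℂ) * P.limHi i.castSucc (deriv (u i.castSucc)) +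
    (m i 0 : ℂ) * P.limHi i.castSucc (u i.castSucc) +
    (p i 1 : ℂ) * P.limLo i.succ (deriv (u i.succ)) +
    (p i 0 : ℂ) * P.limLo i.succ (u i.succ)

/-- The conditions on the function component of an element of the domain. -/
structure Admissible (u : Fin (n + 1) → ℝ → ℂ) : Prop where
  diff : ∀ k, DifferentiableOn ℝ (u k) (P.Ω k)
  ac : ∀ k, P.ACloc k (u k)
  ac_deriv : ∀ k, P.ACloc k (deriv (u k))
  lo : ∀ k, ∃ l, Tendsto (u k) (𝓝[>] (P.lo k)) (𝓝 l)
  hi : ∀ k, ∃ l, Tendsto (u k) (𝓝[<] (P.hi k)) (𝓝 l)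
  lo_deriv : ∀ k, ∃ l, Tendsto (deriv (u k)) (𝓝[>] (P.lo k)) (𝓝 l)
  hi_deriv : ∀ k, ∃ l, Tendsto (deriv (u k)) (𝓝[<] (P.hi k)) (𝓝 l)
  memLp : ∀ k, MemLp (P.ell u k) 2 (volume.restrict (P.Ω k))
  trans_δ : ∀ i, P.trans P.δm P.δp i u = 0
  trans_γ : ∀ i, P.trans P.γm P.γp i u = 0

/-- `u` is admissible and `F = (u, B'ₐ[u], -B'_b[u])`. -/
structure Represents (u : Fin (n + 1) → ℝ → ℂ) (F : P.Space) : Prop where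
  adm : P.Admissible u
  fn : ∀ k, F.1 k =ᵐ[volume.restrict (P.Ω k)] u k
  fst : F.2.1 = P.Ba' u
  snd : F.2.2 = -P.Bb' u

/-- The element `(ℓ u, Bₐ[u], B_b[u])`. -/
def action (u : Fin (n + 1) → ℝ → ℂ) (hu : P.Admissible u) : P.Space :=
  (fun k => (hu.memLp k).toLp (P.ell u k), P.Ba u, P.Bb u)

/-! ### Auxiliary facts: the operator is well defined and linear -/

variable {P}

theorem lo_lt_hi (P : Problem n) (k : Fin (n + 1)) : P.lo k < P.hi k :=
  P.ξ_strictMono Fin.castSucc_lt_succ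

theorem Ω_mem_lo (P : Problem n) (k : Fin (n + 1)) : P.Ω k ∈ 𝓝[>] (P.lo k) :=
  Ioo_mem_nhdsGT (P.lo_lt_hi k)

theorem Ω_mem_hi (P : Problem n) (k : Fin (n + 1)) : P.Ω k ∈ 𝓝[<] (P.hi k) :=
  Ioo_mem_nhdsLT (P.lo_lt_hi k)

theorem limLo_eq {k : Fin (n + 1)} {g : ℝ → ℂ} {l : ℂ}
    (h : Tendsto g (𝓝[>] (P.lo k)) (𝓝 l)) : P.limLo k g = l := h.limUnder_eq

theorem limHi_eq {k : Fin (n + 1)} {g : ℝ → ℂ} {l : ℂ}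
    (h : Tendsto g (𝓝[<] (P.hi k)) (𝓝 l)) : P.limHi k g = l := h.limUnder_eq

theorem limLo_congr {k : Fin (n + 1)} {g h : ℝ → ℂ} (e : EqOn g h (P.Ω k)) :
    P.limLo k g = P.limLo k h := by
  unfold limLo limUnder
  rw [map_congr (e.eventuallyEq_of_mem (P.Ω_mem_lo k))]

theorem limHi_congr {k : Fin (n + 1)} {g h : ℝ → ℂ} (e : EqOn g h (P.Ω k)) :
    P.limHi k g = P.limHi k h := by
  unfold limHi limUnder
  rw [map_congr (e.eventuallyEq_of_mem (P.Ω_mem_hi k))]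

theorem ACloc.congr {k : Fin (n + 1)} {g h : ℝ → ℂ} (hg : P.ACloc k g)
    (e : EqOn g h (P.Ω k)) : P.ACloc k h := by
  intro s t hst hsub
  have := hg s t hst hsub
  rw [absolutelyContinuousOnInterval_iff] at this ⊢
  intro ε hε
  obtain ⟨d, hd, H⟩ := this ε hε
  refine ⟨d, hd, fun E hE hlt => ?_⟩
  have := H E hE hlt
  rw [← uIcc_of_le hst] at hsub
  have hs : ∑ i ∈ Finset.range E.1, dist (h (E.2 i).1) (h (E.2 i).2) =
      ∑ i ∈ Finset.range E.1, dist (g (E.2 i).1) (g (E.2 i).2) :=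
    Finset.sum_congr rfl fun i hi => by
      rw [e (hsub (hE.1 i hi).1), e (hsub (hE.1 i hi).2)]
  rwa [hs]

theorem ACloc.ae_differentiableAt {k : Fin (n + 1)} {g : ℝ → ℂ} (hg : P.ACloc k g) :
    ∀ᵐ x ∂(volume.restrict (P.Ω k)), DifferentiableAt ℝ g x := by
  rw [ae_restrict_iff' (show MeasurableSet (P.Ω k) from measurableSet_Ioo)]
  have key : ∀ p : ℚ × ℚ, ∀ᵐ x : ℝ, ((p.1 : ℝ) ≤ p.2 ∧ Icc (p.1 : ℝ) p.2 ⊆ P.Ω k) →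
      x ∈ uIcc (p.1 : ℝ) p.2 → DifferentiableAt ℝ g x := by
    intro p
    by_cases hp : (p.1 : ℝ) ≤ p.2 ∧ Icc (p.1 : ℝ) p.2 ⊆ P.Ω k
    · filter_upwards [(hg _ _ hp.1 hp.2).boundedVariationOn.ae_differentiableAt_of_mem_uIcc]
        with x hx _ using hx
    · exact Eventually.of_forall fun x h => absurd h hp
  filter_upwards [ae_all_iff.2 key] with x hx hxΩ
  obtain ⟨s, hs1, hs2⟩ := exists_rat_btwn hxΩ.1
  obtain ⟨t, ht1, ht2⟩ := exists_rat_btwn hxΩ.2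
  have hst : (s : ℝ) ≤ t := (hs2.trans ht1).le
  refine hx (s, t) ⟨hst, fun y hy => ⟨hs1.trans_le hy.1, hy.2.trans_lt ht2⟩⟩ ?_
  rw [uIcc_of_le hst]
  exact ⟨hs2.le, ht1.le⟩

theorem deriv_eqOn {k : Fin (n + 1)} {g h : ℝ → ℂ} (e : EqOn g h (P.Ω k)) :
    EqOn (deriv g) (deriv h) (P.Ω k) := fun _ hx =>
  (e.eventuallyEq_of_mem (isOpen_Ioo.mem_nhds hx)).deriv_eq

theorem Admissible.deriv_add {u v : Fin (n + 1) → ℝ → ℂ} (hu : P.Admissible u)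
    (hv : P.Admissible v) (k : Fin (n + 1)) :
    EqOn (deriv (u k) + deriv (v k)) (deriv ((u + v) k)) (P.Ω k) := fun _ hx =>
  (_root_.deriv_add ((hu.diff k).differentiableAt (isOpen_Ioo.mem_nhds hx))
    ((hv.diff k).differentiableAt (isOpen_Ioo.mem_nhds hx))).symm

theorem deriv_smul' (r : ℂ) (u : Fin (n + 1) → ℝ → ℂ) (k : Fin (n + 1)) :
    deriv ((r • u) k) = r • deriv (u k) := by
  funext x
  exact deriv_const_smul_field r (u k)

theorem Admissible.ell_add {u v : Fin (n + 1) → ℝ → ℂ} (hu : P.Admissible u)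
    (hv : P.Admissible v) (k : Fin (n + 1)) :
    P.ell (u + v) k =ᵐ[volume.restrict (P.Ω k)] P.ell u k + P.ell v k := by
  filter_upwards [(hu.ac_deriv k).ae_differentiableAt, (hv.ac_deriv k).ae_differentiableAt,
    ae_restrict_mem measurableSet_Ioo] with x h1 h2 hx
  have e : deriv (deriv ((u + v) k)) x = deriv (deriv (u k)) x + deriv (deriv (v k)) x := by
    rw [← deriv_eqOn (hu.deriv_add hv k) hx, _root_.deriv_add h1 h2]
  change P.ell (u + v) k x = P.ell u k x + P.ell v k x
  simp only [ell, e]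
  simp only [Pi.add_apply]
  ring

theorem ell_smul (r : ℂ) (u : Fin (n + 1) → ℝ → ℂ) (k : Fin (n + 1)) :
    P.ell (r • u) k = r • P.ell u k := by
  funext x
  have e : deriv (deriv ((r • u) k)) x = r • deriv (deriv (u k)) x := by
    rw [deriv_smul']
    exact deriv_const_smul_field r (deriv (u k))
  change P.ell (r • u) k x = r • P.ell u k x
  simp only [ell, e]
  simp only [Pi.smul_apply, smul_eq_mul]
  ring

section limits

variable {u v : Fin (n + 1) → ℝ → ℂ}

theorem Admissible.limLo_add (hu : P.Admissible u) (hv : P.Admissible v) (k : Fin (n + 1)) :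
    P.limLo k ((u + v) k) = P.limLo k (u k) + P.limLo k (v k) := by
  obtain ⟨l, hl⟩ := hu.lo k
  obtain ⟨m, hm⟩ := hv.lo k
  rw [limLo_eq hl, limLo_eq hm]
  exact limLo_eq (hl.add hm)

theorem Admissible.limHi_add (hu : P.Admissible u) (hv : P.Admissible v) (k : Fin (n + 1)) :
    P.limHi k ((u + v) k) = P.limHi k (u k) + P.limHi k (v k) := by
  obtain ⟨l, hl⟩ := hu.hi k
  obtain ⟨m, hm⟩ := hv.hi k
  rw [limHi_eq hl, limHi_eq hm]
  exact limHi_eq (hl.add hm)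

theorem Admissible.limLo_deriv_add (hu : P.Admissible u) (hv : P.Admissible v)
    (k : Fin (n + 1)) : P.limLo k (deriv ((u + v) k)) =
      P.limLo k (deriv (u k)) + P.limLo k (deriv (v k)) := by
  obtain ⟨l, hl⟩ := hu.lo_deriv k
  obtain ⟨m, hm⟩ := hv.lo_deriv k
  rw [limLo_eq hl, limLo_eq hm, ← limLo_congr (hu.deriv_add hv k)]
  exact limLo_eq (hl.add hm)

theorem Admissible.limHi_deriv_add (hu : P.Admissible u) (hv : P.Admissible v)
    (k : Fin (n + 1)) : P.limHi k (deriv ((u + v) k)) =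
      P.limHi k (deriv (u k)) + P.limHi k (deriv (v k)) := by
  obtain ⟨l, hl⟩ := hu.hi_deriv k
  obtain ⟨m, hm⟩ := hv.hi_deriv k
  rw [limHi_eq hl, limHi_eq hm, ← limHi_congr (hu.deriv_add hv k)]
  exact limHi_eq (hl.add hm)

theorem Admissible.limLo_smul (hu : P.Admissible u) (r : ℂ) (k : Fin (n + 1)) :
    P.limLo k ((r • u) k) = r * P.limLo k (u k) := by
  obtain ⟨l, hl⟩ := hu.lo k
  rw [limLo_eq hl]
  exact limLo_eq (hl.const_smul r)

theorem Admissible.limHi_smul (hu : P.Admissible u) (r : ℂ) (k : Fin (n + 1)) :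
    P.limHi k ((r • u) k) = r * P.limHi k (u k) := by
  obtain ⟨l, hl⟩ := hu.hi k
  rw [limHi_eq hl]
  exact limHi_eq (hl.const_smul r)

theorem Admissible.limLo_deriv_smul (hu : P.Admissible u) (r : ℂ) (k : Fin (n + 1)) :
    P.limLo k (deriv ((r • u) k)) = r * P.limLo k (deriv (u k)) := by
  obtain ⟨l, hl⟩ := hu.lo_deriv k
  rw [limLo_eq hl, deriv_smul']
  exact limLo_eq (hl.const_smul r)

theorem Admissible.limHi_deriv_smul (hu : P.Admissible u) (r : ℂ) (k : Fin (n + 1)) :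
    P.limHi k (deriv ((r • u) k)) = r * P.limHi k (deriv (u k)) := by
  obtain ⟨l, hl⟩ := hu.hi_deriv k
  rw [limHi_eq hl, deriv_smul']
  exact limHi_eq (hl.const_smul r)

theorem Admissible.trans_add (hu : P.Admissible u) (hv : P.Admissible v)
    (m p : Fin n → Fin 2 → ℝ) (i : Fin n) :
    P.trans m p i (u + v) = P.trans m p i u + P.trans m p i v := by
  simp only [trans, hu.limLo_add hv, hu.limHi_add hv, hu.limLo_deriv_add hv,
    hu.limHi_deriv_add hv]
  ring

theorem Admissible.trans_smul (hu : P.Admissible u) (r : ℂ)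
    (m p : Fin n → Fin 2 → ℝ) (i : Fin n) :
    P.trans m p i (r • u) = r * P.trans m p i u := by
  simp only [trans, hu.limLo_smul, hu.limHi_smul, hu.limLo_deriv_smul, hu.limHi_deriv_smul]
  ring

theorem Admissible.add (hu : P.Admissible u) (hv : P.Admissible v) : P.Admissible (u + v) where
  diff k := (hu.diff k).add (hv.diff k)
  ac k s t h1 h2 := (hu.ac k s t h1 h2).add (hv.ac k s t h1 h2)
  ac_deriv k := ACloc.congr (g := deriv (u k) + deriv (v k))
    (fun s t h1 h2 => (hu.ac_deriv k s t h1 h2).add (hv.ac_deriv k s t h1 h2)) (hu.deriv_add hv k)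
  lo k := by
    obtain ⟨l, hl⟩ := hu.lo k
    obtain ⟨m, hm⟩ := hv.lo k
    exact ⟨_, hl.add hm⟩
  hi k := by
    obtain ⟨l, hl⟩ := hu.hi k
    obtain ⟨m, hm⟩ := hv.hi k
    exact ⟨_, hl.add hm⟩
  lo_deriv k := by
    obtain ⟨l, hl⟩ := hu.lo_deriv k
    obtain ⟨m, hm⟩ := hv.lo_deriv k
    exact ⟨_, (hl.add hm).congr' ((hu.deriv_add hv k).eventuallyEq_of_mem (P.Ω_mem_lo k))⟩
  hi_deriv k := by
    obtain ⟨l, hl⟩ := hu.hi_deriv k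
    obtain ⟨m, hm⟩ := hv.hi_deriv k
    exact ⟨_, (hl.add hm).congr' ((hu.deriv_add hv k).eventuallyEq_of_mem (P.Ω_mem_hi k))⟩
  memLp k := ((hu.memLp k).add (hv.memLp k)).ae_eq (hu.ell_add hv k).symm
  trans_δ i := by rw [hu.trans_add hv, hu.trans_δ, hv.trans_δ, add_zero]
  trans_γ i := by rw [hu.trans_add hv, hu.trans_γ, hv.trans_γ, add_zero]

theorem Admissible.smul (hu : P.Admissible u) (r : ℂ) : P.Admissible (r • u) where
  diff k := (hu.diff k).const_smul r
  ac k s t h1 h2 := (hu.ac k s t h1 h2).const_smul r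
  ac_deriv k s t h1 h2 := by
    rw [deriv_smul']
    exact (hu.ac_deriv k s t h1 h2).const_smul r
  lo k := by
    obtain ⟨l, hl⟩ := hu.lo k
    exact ⟨_, hl.const_smul r⟩
  hi k := by
    obtain ⟨l, hl⟩ := hu.hi k
    exact ⟨_, hl.const_smul r⟩
  lo_deriv k := by
    obtain ⟨l, hl⟩ := hu.lo_deriv k
    rw [deriv_smul']
    exact ⟨_, hl.const_smul r⟩
  hi_deriv k := by
    obtain ⟨l, hl⟩ := hu.hi_deriv k
    rw [deriv_smul']
    exact ⟨_, hl.const_smul r⟩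
  memLp k := by
    rw [ell_smul]
    exact (hu.memLp k).const_smul r
  trans_δ i := by rw [hu.trans_smul, hu.trans_δ, mul_zero]
  trans_γ i := by rw [hu.trans_smul, hu.trans_γ, mul_zero]

theorem action_add (hu : P.Admissible u) (hv : P.Admissible v) :
    P.action (u + v) (hu.add hv) = P.action u hu + P.action v hv := by
  refine Prod.ext (funext fun k => ?_) (Prod.ext ?_ ?_)
  · change ((hu.add hv).memLp k).toLp _ = (hu.memLp k).toLp _ + (hv.memLp k).toLp _
    rw [← MemLp.toLp_add, MemLp.toLp_eq_toLp_iff]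
    exact hu.ell_add hv k
  · change P.Ba (u + v) = P.Ba u + P.Ba v
    simp only [Ba, hu.limLo_add hv, hu.limLo_deriv_add hv]
    ring
  · change P.Bb (u + v) = P.Bb u + P.Bb v
    simp only [Bb, hu.limHi_add hv, hu.limHi_deriv_add hv]
    ring

theorem action_smul (hu : P.Admissible u) (r : ℂ) :
    P.action (r • u) (hu.smul r) = r • P.action u hu := by
  refine Prod.ext (funext fun k => ?_) (Prod.ext ?_ ?_)
  · change ((hu.smul r).memLp k).toLp _ = r • (hu.memLp k).toLp _
    rw [← MemLp.toLp_const_smul, MemLp.toLp_eq_toLp_iff]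
    exact Eventually.of_forall fun x => congrFun (ell_smul r u k) x
  · change P.Ba (r • u) = r * P.Ba u
    simp only [Ba, hu.limLo_smul, hu.limLo_deriv_smul]
    ring
  · change P.Bb (r • u) = r * P.Bb u
    simp only [Bb, hu.limHi_smul, hu.limHi_deriv_smul]
    ring

end limits

theorem Represents.add {u v : Fin (n + 1) → ℝ → ℂ} {F G : P.Space} (hu : P.Represents u F)
    (hv : P.Represents v G) : P.Represents (u + v) (F + G) where
  adm := hu.adm.add hv.adm
  fn k := (Lp.coeFn_add (F.1 k) (G.1 k)).trans ((hu.fn k).add (hv.fn k))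
  fst := by
    change F.2.1 + G.2.1 = _
    rw [hu.fst, hv.fst]
    simp only [Ba', hu.adm.limLo_add hv.adm, hu.adm.limLo_deriv_add hv.adm]
    ring
  snd := by
    change F.2.2 + G.2.2 = _
    rw [hu.snd, hv.snd]
    simp only [Bb', hu.adm.limHi_add hv.adm, hu.adm.limHi_deriv_add hv.adm]
    ring

theorem Represents.smul {u : Fin (n + 1) → ℝ → ℂ} {F : P.Space} (hu : P.Represents u F) (r : ℂ) :
    P.Represents (r • u) (r • F) where
  adm := hu.adm.smul r
  fn k := (Lp.coeFn_smul r (F.1 k)).trans ((hu.fn k).const_smul r)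
  fst := by
    change r * F.2.1 = _
    rw [hu.fst]
    simp only [Ba', hu.adm.limLo_smul, hu.adm.limLo_deriv_smul]
    ring
  snd := by
    change r * F.2.2 = _
    rw [hu.snd]
    simp only [Bb', hu.adm.limHi_smul, hu.adm.limHi_deriv_smul]
    ring

theorem represents_zero : P.Represents 0 0 := by
  have d0 : ∀ k, deriv ((0 : Fin (n + 1) → ℝ → ℂ) k) = fun _ => 0 := fun k => by
    funext x
    exact deriv_const x (0 : ℂ)
  have ac0 : ∀ s t : ℝ, AbsolutelyContinuousOnInterval (fun _ : ℝ => (0 : ℂ)) s t := fun s t =>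
    contDiff_const.contDiffOn.absolutelyContinuousOnInterval
  have l0 : ∀ k, P.limLo k (fun _ => 0) = 0 := fun k => limLo_eq tendsto_const_nhds
  have h0 : ∀ k, P.limHi k (fun _ => 0) = 0 := fun k => limHi_eq tendsto_const_nhds
  have l1 : ∀ k, P.limLo k ((0 : Fin (n + 1) → ℝ → ℂ) k) = 0 := l0
  have h1 : ∀ k, P.limHi k ((0 : Fin (n + 1) → ℝ → ℂ) k) = 0 := h0
  refine ⟨⟨fun _ => differentiableOn_const 0, fun _ s t _ _ => ac0 s t, fun k s t _ _ => ?_,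
    fun _ => ⟨0, tendsto_const_nhds⟩, fun _ => ⟨0, tendsto_const_nhds⟩, fun k => ?_, fun k => ?_,
    fun k => ?_, fun i => ?_, fun i => ?_⟩, fun k => Lp.coeFn_zero _ _ _, ?_, ?_⟩
  · rw [d0]
    exact ac0 s t
  · rw [d0]
    exact ⟨0, tendsto_const_nhds⟩
  · rw [d0]
    exact ⟨0, tendsto_const_nhds⟩
  · have : P.ell 0 k = 0 := by simpa using ell_smul (P := P) 0 0 k
    rw [this]
    exact MemLp.zero
  · simp only [trans, d0, l0, h0, l1, h1, mul_zero, add_zero]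
  · simp only [trans, d0, l0, h0, l1, h1, mul_zero, add_zero]
  · change (0 : ℂ) = _
    simp only [Ba', d0, l0, l1, mul_zero, sub_zero]
  · change (0 : ℂ) = _
    simp only [Bb', d0, h0, h1, mul_zero, sub_zero, neg_zero]

/-- The representative is unique on the intervals. -/
theorem Represents.eqOn {u v : Fin (n + 1) → ℝ → ℂ} {F : P.Space} (hu : P.Represents u F)
    (hv : P.Represents v F) (k : Fin (n + 1)) : EqOn (u k) (v k) (P.Ω k) :=
  Measure.eqOn_open_of_ae_eq ((hu.fn k).symm.trans (hv.fn k)) isOpen_Ioo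
    (hu.adm.diff k).continuousOn (hv.adm.diff k).continuousOn

theorem Represents.action_eq {u v : Fin (n + 1) → ℝ → ℂ} {F : P.Space} (hu : P.Represents u F)
    (hv : P.Represents v F) : P.action u hu.adm = P.action v hv.adm := by
  have e := hu.eqOn hv
  have e' := fun k => deriv_eqOn (e k)
  have e'' := fun k => deriv_eqOn (e' k)
  refine Prod.ext (funext fun k => ?_) (Prod.ext ?_ ?_)
  · change (hu.adm.memLp k).toLp _ = (hv.adm.memLp k).toLp _
    rw [MemLp.toLp_eq_toLp_iff]
    filter_upwards [ae_restrict_mem measurableSet_Ioo] with x hx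
    simp only [ell, e k hx, e'' k hx]
  · change P.Ba u = P.Ba v
    simp only [Ba, limLo_congr (e 0), limLo_congr (e' 0)]
  · change P.Bb u = P.Bb v
    simp only [Bb, limHi_congr (e (Fin.last n)), limHi_congr (e' (Fin.last n))]

/-! ### The operator -/

variable (P)

/-- The domain: all `F = (u, B'ₐ[u], -B'_b[u])` with `u` admissible. -/
def domain : Submodule ℂ P.Space where
  carrier := {F | ∃ u, P.Represents u F}
  add_mem' := by
    rintro F G ⟨u, hu⟩ ⟨v, hv⟩
    exact ⟨u + v, hu.add hv⟩
  zero_mem' := ⟨0, represents_zero⟩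
  smul_mem' := by
    rintro r F ⟨u, hu⟩
    exact ⟨r • u, hu.smul r⟩

/-- The operator `(u, B'ₐ[u], -B'_b[u]) ↦ (ℓ u, Bₐ[u], B_b[u])`; see `operator_apply`. -/
def operator : P.Space →ₗ.[ℂ] P.Space where
  domain := P.domain
  toFun :=
    { toFun := fun F => P.action F.2.choose F.2.choose_spec.adm
      map_add' := fun F G => by
        rw [← action_add]
        exact (F + G).2.choose_spec.action_eq (F.2.choose_spec.add G.2.choose_spec)
      map_smul' := fun r F => by
        rw [RingHom.id_apply, ← action_smul]
        exact (r • F).2.choose_spec.action_eq (F.2.choose_spec.smul r) }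

theorem operator_apply {u : Fin (n + 1) → ℝ → ℂ} {F : P.Space} (hu : P.Represents u F) :
    P.operator ⟨F, u, hu⟩ = P.action u hu.adm :=
  Represents.action_eq (Exists.choose_spec (⟨u, hu⟩ : ∃ u, P.Represents u F)) hu

end Problem

end SturmTransmission

end

open scoped BoundedContinuousFunction

noncomputable section

/-! The inclusion of the eigenvalues in the spectrum is formal. For the converse, let `z` be no
eigenvalue; a bounded inverse of `z - T`, with `T` the operator, is built by solving an ordinary
differential equation, without any appeal to self-adjointness or compactness.

On one interval `z u - ℓ u = g` is a linear second-order equation with continuous potential.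
Inverting a Volterra operator yields a solution that is a bounded linear function of its initial
values and of `g ∈ L²` (`exists_solvesOn`). At each interior node `θ i 0 1 ≠ 0` lets the
transmission conditions be solved for the right-hand limits (`exists_transfer`). Hence initial data
`y = (u(a), u'(a))` and `g` produce a solution on all intervals, boundedly and linearly
(`exists_solves`).

What remains is to match the two components in `ℂ²`, which are two linear equations for `y`. A
nonzero `y` in the kernel of this 2×2 system would give an eigenvector (`Solves.initial_eq_zero`),
so the system is injective, hence invertible. Its solution is a bounded function of the right-hand
side, and so is the resulting preimage. As `z - T` is injective, this right inverse is two-sided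
(`mem_resolventSet_of_rightInverse`). -/

namespace LinearODE

/-! ### Volterra operators and linear initial value problems with square integrable forcing -/

variable {E : Type*} [NormedAddCommGroup E]
  {E' : Type*} [NormedAddCommGroup E']
  {a b : ℝ}

/-- The map `x ↦ max a (min b x)` retracts the line onto `[a, b]`. Composing with it extends
functions by constants, so that solutions live in the Banach space `ℝ →ᵇ E` and boundary values are
plain evaluations. -/
theorem clamp_mem (hab : a ≤ b) (x : ℝ) : max a (min b x) ∈ Icc a b :=
  ⟨le_max_left _ _, max_le hab (min_le_left _ _)⟩

theorem clamp_of_mem {x : ℝ} (hx : x ∈ Icc a b) : max a (min b x) = x := by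
  rw [min_eq_right hx.2, max_eq_right hx.1]

theorem intervalIntegrable_of_Ioo {f : ℝ → E'}
    (hf : IntegrableOn f (Ioo a b)) {x : ℝ} (hx : x ∈ Icc a b) :
    IntervalIntegrable f volume a x := by
  rw [intervalIntegrable_iff_integrableOn_Ioo_of_le hx.1]
  exact hf.mono_set (Ioo_subset_Ioo_right hx.2)

variable {𝕜 : Type*} [RCLike 𝕜] [NormedSpace 𝕜 E] [NormedSpace 𝕜 E']

theorem exists_bound_Icc {A : ℝ → E →L[𝕜] E} (hA : Continuous A) (a b : ℝ) :
    ∃ C, 0 ≤ C ∧ ∀ t ∈ Icc a b, ‖A t‖ ≤ C := by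
  obtain ⟨C, hC⟩ := isCompact_Icc.exists_bound_of_continuousOn (s := Icc a b) hA.continuousOn
  exact ⟨max C 0, le_max_right _ _, fun t ht => (hC t ht).trans (le_max_left _ _)⟩

theorem integrableOn_apply {A : ℝ → E →L[𝕜] E} (hA : Continuous A) (Y : ℝ →ᵇ E) :
    IntegrableOn (fun t => A t (Y t)) (Ioo a b) :=
  ((hA.clm_apply Y.continuous).continuousOn.integrableOn_Icc (a := a) (b := b)).mono_set
    Ioo_subset_Icc_self

theorem integrableOn_Lp (B : E' →L[𝕜] E) (g : Lp E' 2 (volume.restrict (Ioo a b))) :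
    IntegrableOn (fun t => B (g t)) (Ioo a b) :=
  B.integrable_comp ((Lp.memLp g).integrable (by norm_num))

variable [NormedSpace ℝ E]

theorem norm_integral_le_integral_Ioo {f : ℝ → E}
    (hf : IntegrableOn f (Ioo a b)) {x : ℝ} (hx : x ∈ Icc a b) :
    ‖∫ t in a..x, f t‖ ≤ ∫ t in Ioo a b, ‖f t‖ := by
  rw [intervalIntegral.integral_of_le hx.1, integral_Ioc_eq_integral_Ioo]
  refine (norm_integral_le_integral_norm _).trans ?_
  exact setIntegral_mono_set hf.norm (ae_of_all _ fun _ => norm_nonneg _)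
    (Ioo_subset_Ioo_right hx.2).eventuallyLE

/-- The primitive of `f` on `[a, b]` that vanishes at `a`, extended to `ℝ` by constants. -/
def primitive (hab : a ≤ b) (f : ℝ → E) (hf : IntegrableOn f (Ioo a b)) : ℝ →ᵇ E :=
  BoundedContinuousFunction.ofNormedAddCommGroup (fun x => ∫ t in a..max a (min b x), f t)
    (by
      have h := intervalIntegral.continuousOn_primitive_interval (μ := volume) (f := f)
        (a := a) (b := b) (by
          rw [uIcc_of_le hab, integrableOn_Icc_iff_integrableOn_Ioo]; exact hf)
      rw [uIcc_of_le hab] at h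
      exact h.comp_continuous (by fun_prop) (clamp_mem hab))
    (∫ t in Ioo a b, ‖f t‖)
    (fun x => norm_integral_le_integral_Ioo hf (clamp_mem hab x))

theorem primitive_apply (hab : a ≤ b) (f : ℝ → E) (hf : IntegrableOn f (Ioo a b)) (x : ℝ) :
    primitive hab f hf x = ∫ t in a..max a (min b x), f t := rfl

theorem norm_primitive_le (hab : a ≤ b) (f : ℝ → E) (hf : IntegrableOn f (Ioo a b)) :
    ‖primitive hab f hf‖ ≤ ∫ t in Ioo a b, ‖f t‖ :=
  BoundedContinuousFunction.norm_ofNormedAddCommGroup_le _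
    (integral_nonneg fun _ => norm_nonneg _) _

variable [SMulCommClass ℝ 𝕜 E]

/-- The Volterra operator `Y ↦ ∫ₐˣ A Y`. -/
def volterra (hab : a ≤ b) {A : ℝ → E →L[𝕜] E} (hA : Continuous A) :
    (ℝ →ᵇ E) →L[𝕜] (ℝ →ᵇ E) :=
  LinearMap.mkContinuousOfExistsBound
    { toFun := fun Y => primitive hab (fun t => A t (Y t)) (integrableOn_apply hA Y)
      map_add' := fun Y Z => by
        ext x
        simp only [primitive_apply, BoundedContinuousFunction.add_apply, map_add]
        exact intervalIntegral.integral_add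
          (intervalIntegrable_of_Ioo (integrableOn_apply hA Y) (clamp_mem hab x))
          (intervalIntegrable_of_Ioo (integrableOn_apply hA Z) (clamp_mem hab x))
      map_smul' := fun r Y => by
        ext x
        simp only [primitive_apply, BoundedContinuousFunction.smul_apply, map_smul, RingHom.id_apply]
        exact intervalIntegral.integral_smul r _ }
    (by
      obtain ⟨C, hC0, hC⟩ := exists_bound_Icc hA a b
      refine ⟨C * (b - a), fun Y => (norm_primitive_le hab _ (integrableOn_apply hA Y)).trans ?_⟩
      calc ∫ t in Ioo a b, ‖A t (Y t)‖ ≤ ∫ t in Ioo a b, C * ‖Y‖ := by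
            refine setIntegral_mono_on (integrableOn_apply hA Y).norm
              (integrableOn_const (by simp)) measurableSet_Ioo fun t ht => ?_
            exact (A t).le_of_opNorm_le_of_le (hC t (Ioo_subset_Icc_self ht)) (Y.norm_coe_le_norm t)
        _ = C * (b - a) * ‖Y‖ := by
            simp [Measure.real, hab]; ring)

theorem volterra_apply (hab : a ≤ b) {A : ℝ → E →L[𝕜] E} (hA : Continuous A) (Y : ℝ →ᵇ E)
    (x : ℝ) : volterra hab hA Y x = ∫ t in a..max a (min b x), A t (Y t) := rfl

/-- Each further application integrates the previous bound, and integrating `(t - a) ^ n` supplies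
the next factor of the factorial. -/
theorem norm_volterra_pow_apply_le (hab : a ≤ b) {A : ℝ → E →L[𝕜] E} (hA : Continuous A) {C : ℝ}
    (hC : ∀ t ∈ Icc a b, ‖A t‖ ≤ C) (n : ℕ) (Y : ℝ →ᵇ E) (x : ℝ) :
    ‖(volterra hab hA ^ n) Y x‖ ≤
      C ^ n * (max a (min b x) - a) ^ n / n.factorial * ‖Y‖ := by
  induction n generalizing x with
  | zero => simpa using Y.norm_coe_le_norm x
  | succ n ih =>
    rw [pow_succ', mul_apply_eq_comp, volterra_apply]
    have hp := clamp_mem hab x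
    set p := max a (min b x)
    have key : ∀ t ∈ Icc a p, ‖A t ((volterra hab hA ^ n) Y t)‖ ≤
        C ^ (n + 1) / n.factorial * ‖Y‖ * (t - a) ^ n := by
      intro t ht
      have ht' : t ∈ Icc a b := ⟨ht.1, ht.2.trans hp.2⟩
      have h := ih t
      rw [clamp_of_mem ht'] at h
      refine ((A t).le_of_opNorm_le_of_le (hC t ht') h).trans (le_of_eq ?_)
      ring
    have hint : ∫ t in a..p, (t - a) ^ n = (p - a) ^ (n + 1) / (n + 1) := by
      rw [intervalIntegral.integral_comp_sub_right (fun t => t ^ n) a]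
      simp
    calc ‖∫ t in a..p, A t ((volterra hab hA ^ n) Y t)‖
        ≤ ∫ t in a..p, C ^ (n + 1) / n.factorial * ‖Y‖ * (t - a) ^ n := by
          refine intervalIntegral.norm_integral_le_of_norm_le hp.1 (ae_of_all _ fun t ht =>
            key t (Ioc_subset_Icc_self ht)) ?_
          exact Continuous.intervalIntegrable (by fun_prop) _ _
      _ = C ^ (n + 1) * (p - a) ^ (n + 1) / (n + 1).factorial * ‖Y‖ := by
          rw [intervalIntegral.integral_const_mul, hint, Nat.factorial_succ]
          push_cast
          field_simp

/-- The Volterra operator `K` itself may have large norm, but the factorial bound gives `‖K ^ n‖ <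
1` for some `n`. Then `1 - K ^ n` is a unit and factors as `1 - K` times a geometric sum; the
factors commute, so each is a unit. -/
theorem isUnit_one_sub_volterra [CompleteSpace E] (hab : a ≤ b) {A : ℝ → E →L[𝕜] E}
    (hA : Continuous A) : IsUnit (1 - volterra hab hA) := by
  obtain ⟨C, hC0, hC⟩ := exists_bound_Icc hA a b
  have hlim := FloorSemiring.tendsto_pow_div_factorial_atTop (C * (b - a))
  obtain ⟨n, hn⟩ := (hlim.eventually_lt_const (u := (1 : ℝ)) one_pos).exists
  have hba : 0 ≤ b - a := sub_nonneg.2 hab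
  have hnorm : ‖volterra hab hA ^ n‖ < 1 := by
    refine lt_of_le_of_lt (ContinuousLinearMap.opNorm_le_bound _ (by positivity) fun Y => ?_) hn
    refine (BoundedContinuousFunction.norm_le (by positivity)).2 fun x => ?_
    refine (norm_volterra_pow_apply_le hab hA hC n Y x).trans ?_
    have hp := clamp_mem hab x
    have h1 : 0 ≤ max a (min b x) - a := sub_nonneg.2 hp.1
    rw [mul_pow]
    gcongr
    exact hp.2
  have hu := isUnit_one_sub_of_norm_lt_one hnorm
  have hcomm : Commute (1 - volterra hab hA) (∑ i ∈ Finset.range n, volterra hab hA ^ i) :=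
    Commute.sum_right _ _ _ fun i _ =>
      (Commute.one_left _).sub_left ((Commute.refl _).pow_right i)
  rw [← mul_neg_geom_sum] at hu
  exact (hcomm.isUnit_mul_iff.1 hu).1

/-- The map taking a square integrable `g` to the primitive of `B g`. -/
def forcing (hab : a ≤ b) (B : E' →L[𝕜] E) :
    Lp E' 2 (volume.restrict (Ioo a b)) →L[𝕜] (ℝ →ᵇ E) :=
  LinearMap.mkContinuousOfExistsBound
    { toFun := fun g => primitive hab (fun t => B (g t)) (integrableOn_Lp B g)
      map_add' := fun f g => by
        ext x
        simp only [primitive_apply, BoundedContinuousFunction.add_apply]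
        rw [← intervalIntegral.integral_add
          (intervalIntegrable_of_Ioo (integrableOn_Lp B f) (clamp_mem hab x))
          (intervalIntegrable_of_Ioo (integrableOn_Lp B g) (clamp_mem hab x)),
          intervalIntegral.integral_of_le (clamp_mem hab x).1,
          intervalIntegral.integral_of_le (clamp_mem hab x).1,
          integral_Ioc_eq_integral_Ioo, integral_Ioc_eq_integral_Ioo]
        refine integral_congr_ae (ae_restrict_of_ae_restrict_of_subset
          (Ioo_subset_Ioo_right (clamp_mem hab x).2) ?_)
        filter_upwards [Lp.coeFn_add f g] with t ht
        rw [ht, Pi.add_apply, map_add]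
      map_smul' := fun r g => by
        ext x
        simp only [primitive_apply, BoundedContinuousFunction.smul_apply, RingHom.id_apply]
        rw [← intervalIntegral.integral_smul r,
          intervalIntegral.integral_of_le (clamp_mem hab x).1,
          intervalIntegral.integral_of_le (clamp_mem hab x).1,
          integral_Ioc_eq_integral_Ioo, integral_Ioc_eq_integral_Ioo]
        refine integral_congr_ae (ae_restrict_of_ae_restrict_of_subset
          (Ioo_subset_Ioo_right (clamp_mem hab x).2) ?_)
        filter_upwards [Lp.coeFn_smul r g] with t ht
        rw [ht, Pi.smul_apply, map_smul] }
    (by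
      -- The constant is that of Cauchy–Schwarz: on a finite measure space the `L¹` norm is at most
      -- `μ(univ) ^ (1/2)` times the `L²` norm.
      set μ := volume.restrict (Ioo a b)
      refine ⟨‖B‖ * (μ univ).toReal ^ (1 / (1 : ℝ) - 1 / 2), fun g =>
        (norm_primitive_le hab _ (integrableOn_Lp B g)).trans ?_⟩
      have hg := Lp.memLp g
      have hg1 : MemLp g 1 μ := hg.mono_exponent (by norm_num)
      have h1 : ∫ t, ‖B (g t)‖ ∂μ ≤ ‖B‖ * ∫ t, ‖g t‖ ∂μ := by
        rw [← integral_const_mul]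
        exact integral_mono (integrableOn_Lp B g).norm ((hg1.integrable le_rfl).norm.const_mul _)
          fun t => B.le_opNorm _
      refine h1.trans ?_
      rw [mul_assoc]
      gcongr
      have h2 := eLpNorm_le_eLpNorm_mul_rpow_measure_univ (μ := μ) (p := 1) (q := 2)
        (by norm_num) hg.1
      rw [integral_norm_eq_lintegral_enorm hg.1, ← eLpNorm_one_eq_lintegral_enorm, Lp.norm_def,
        ENNReal.toReal_rpow, ← ENNReal.toReal_mul, mul_comm]
      refine ENNReal.toReal_mono ?_ (by simpa using h2)
      exact ENNReal.mul_ne_top hg.2.ne (ENNReal.rpow_ne_top_of_nonneg (by norm_num)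
        (measure_ne_top _ _)))

theorem forcing_apply (hab : a ≤ b) (B : E' →L[𝕜] E) (g : Lp E' 2 (volume.restrict (Ioo a b)))
    (x : ℝ) : forcing hab B g x = ∫ t in a..max a (min b x), B (g t) := rfl

/-- The initial value problem `Y' = A Y + B g`, `Y a = y` has a solution that depends linearly and
continuously on `y` and on the square integrable function `g`. -/
theorem exists_solution [CompleteSpace E] (hab : a ≤ b) {A : ℝ → E →L[𝕜] E} (hA : Continuous A)
    (B : E' →L[𝕜] E) :
    ∃ S : E × Lp E' 2 (volume.restrict (Ioo a b)) →L[𝕜] (ℝ →ᵇ E), ∀ w, ∀ x ∈ Icc a b,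
      S w x = w.1 + ∫ t in a..x, (A t (S w t) + B (w.2 t)) := by
  -- In integrated form the problem reads `(1 - volterra) Y = R w`, where `R w` is the constant `y`
  -- plus the primitive of `B g`; the solution map is therefore the inverse composed with `R`.
  obtain ⟨u, hu⟩ := isUnit_one_sub_volterra hab hA
  let K : E →L[𝕜] (ℝ →ᵇ E) := LinearMap.mkContinuous
    { toFun := BoundedContinuousFunction.const ℝ
      map_add' := fun _ _ => rfl
      map_smul' := fun _ _ => rfl } 1
    (fun y => by rw [one_mul]; exact BoundedContinuousFunction.norm_const_le y)
  let R : E × Lp E' 2 (volume.restrict (Ioo a b)) →L[𝕜] (ℝ →ᵇ E) :=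
    K.coprod (forcing hab B)
  let S := (u⁻¹).1 ∘L R
  refine ⟨S, fun w x hx => ?_⟩
  have h1 : (1 - volterra hab hA) (S w) = R w := by
    rw [← hu]
    change (u.1 * (u⁻¹).1) (R w) = R w
    rw [Units.mul_inv]; rfl
  have h2 := DFunLike.congr_fun h1 x
  have h3 : R w x = w.1 + ∫ t in a..x, B (w.2 t) := by
    change w.1 + forcing hab B w.2 x = _
    rw [forcing_apply, clamp_of_mem hx]
  have h4 : ((1 - volterra hab hA) (S w)) x = S w x - ∫ t in a..x, A t (S w t) := by
    change S w x - volterra hab hA (S w) x = _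
    rw [volterra_apply, clamp_of_mem hx]
  rw [h3, h4, sub_eq_iff_eq_add] at h2
  rw [h2, intervalIntegral.integral_add
    (intervalIntegrable_of_Ioo (integrableOn_apply hA _) hx)
    (intervalIntegrable_of_Ioo (integrableOn_Lp B _) hx)]
  abel

/-- The initial value problem `u' = v`, `v' = c u + g` has a solution that depends linearly and
continuously on the initial values and on the square integrable function `g`. -/
theorem exists_second_order_solution {a b : ℝ} (hab : a ≤ b) {c : ℝ → ℂ} (hc : Continuous c) :
    ∃ U V : (ℂ × ℂ) × Lp ℂ 2 (volume.restrict (Ioo a b)) →L[ℂ] (ℝ →ᵇ ℂ), ∀ w, ∀ x ∈ Icc a b,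
      U w x = w.1.1 + (∫ t in a..x, V w t) ∧
      V w x = w.1.2 + ∫ t in a..x, (c t * U w t + w.2 t) := by
  -- The equation as a first-order system for the pair `(u, v)`; the forcing enters the second
  -- component only.
  let A : ℝ → (ℂ × ℂ) →L[ℂ] (ℂ × ℂ) := fun t =>
    (ContinuousLinearMap.inl ℂ ℂ ℂ) ∘L (ContinuousLinearMap.snd ℂ ℂ ℂ) +
      c t • (ContinuousLinearMap.inr ℂ ℂ ℂ) ∘L (ContinuousLinearMap.fst ℂ ℂ ℂ)
  have hA : Continuous A := continuous_const.add (hc.smul continuous_const)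
  have hA1 : ∀ t y, A t y = (y.2, c t * y.1) := fun t y => by simp [A]
  obtain ⟨S, hS⟩ := exists_solution hab hA (ContinuousLinearMap.inr ℂ ℂ ℂ)
  refine ⟨(ContinuousLinearMap.fst ℂ ℂ ℂ).compLeftContinuousBounded ℝ ∘L S,
    (ContinuousLinearMap.snd ℂ ℂ ℂ).compLeftContinuousBounded ℝ ∘L S, fun w x hx => ?_⟩
  have hint : IntervalIntegrable
      (fun t => A t (S w t) + ContinuousLinearMap.inr ℂ ℂ ℂ (w.2 t)) volume a x :=
    (intervalIntegrable_of_Ioo (integrableOn_apply hA _) hx).add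
      (intervalIntegrable_of_Ioo (integrableOn_Lp (ContinuousLinearMap.inr ℂ ℂ ℂ) w.2) hx)
  have h1 := (ContinuousLinearMap.fst ℝ ℂ ℂ).intervalIntegral_comp_comm hint
  have h2 := (ContinuousLinearMap.snd ℝ ℂ ℂ).intervalIntegral_comp_comm hint
  simp only [hA1, ContinuousLinearMap.inr_apply, ContinuousLinearMap.coe_fst',
    ContinuousLinearMap.coe_snd', Prod.fst_add, Prod.snd_add, add_zero] at h1 h2
  have h := hS w x hx
  simp only [hA1, ContinuousLinearMap.inr_apply] at h
  constructor
  · change (S w x).1 = w.1.1 + ∫ t in a..x, (S w t).2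
    rw [h1, h]; rfl
  · change (S w x).2 = w.1.2 + ∫ t in a..x, (c t * (S w t).1 + w.2 t)
    rw [h2, h]; rfl

/-- The real-valued case applies to the real and the imaginary part, and the primitive is recovered
as their combination with coefficients `1` and `I`. -/
theorem absolutelyContinuousOnInterval_integral {f : ℝ → ℂ} {a b c : ℝ}
    (h : IntervalIntegrable f volume a b) (hc : c ∈ uIcc a b) :
    AbsolutelyContinuousOnInterval (fun x => ∫ t in c..x, f t) a b := by
  have hre : IntervalIntegrable (fun t => (f t).re) volume a b := ⟨h.1.re, h.2.re⟩
  have him : IntervalIntegrable (fun t => (f t).im) volume a b := ⟨h.1.im, h.2.im⟩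
  have hconst : ∀ w : ℂ, AbsolutelyContinuousOnInterval (fun _ : ℝ => w) a b := fun w =>
    contDiff_const.contDiffOn.absolutelyContinuousOnInterval
  have hsum := ((hre.absolutelyContinuousOnInterval_intervalIntegral hc).smul (hconst 1)).add
    ((him.absolutelyContinuousOnInterval_intervalIntegral hc).smul (hconst Complex.I))
  have heq : ∀ x ∈ uIcc a b, (∫ t in c..x, f t) =
      (∫ t in c..x, (f t).re) • (1 : ℂ) + (∫ t in c..x, (f t).im) • Complex.I := by
    intro x hx
    have hfx : IntervalIntegrable f volume c x := h.mono_set (uIcc_subset_uIcc hc hx)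
    have h1 := Complex.reCLM.intervalIntegral_comp_comm hfx
    have h2 := Complex.imCLM.intervalIntegral_comp_comm hfx
    simp only [Complex.reCLM_apply, Complex.imCLM_apply] at h1 h2
    rw [h1, h2]
    simp [Complex.re_add_im]
  rw [absolutelyContinuousOnInterval_iff] at hsum ⊢
  intro ε hε
  obtain ⟨d, hd, H⟩ := hsum ε hε
  refine ⟨d, hd, fun I hI hlt => ?_⟩
  refine lt_of_eq_of_lt (Finset.sum_congr rfl fun i hi => ?_) (H I hI hlt)
  rw [heq _ (hI.1 i hi).1, heq _ (hI.1 i hi).2]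
  rfl

end LinearODE

/-! ### The differential equation on a single interval -/

namespace SturmTransmission.Problem

variable {n : ℕ} (P : Problem n)

instance (k : Fin (n + 1)) : IsFiniteMeasure (volume.restrict (P.Ω k)) :=
  inferInstanceAs (IsFiniteMeasure (volume.restrict (Ioo (P.lo k) (P.hi k))))

/-- `(q - z) / ρ²` extends continuously from an open interval to the line. -/
theorem exists_continuous_potential (z : ℂ) (k : Fin (n + 1)) :
    ∃ c : ℝ → ℂ, Continuous c ∧
      ∀ x ∈ P.Ω k, ((P.ρ k ^ 2 : ℝ) : ℂ) * c x = (P.q x : ℂ) - z := by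
  obtain ⟨l, hl⟩ := P.q_limit_lo k
  obtain ⟨m, hm⟩ := P.q_limit_hi k
  -- The finite one-sided limits extend `q` continuously to the closed interval; clamping then
  -- carries it to the line.
  have hQ := continuousOn_Icc_extendFrom_Ioo (P.q_continuousOn k) hl hm
  have hab := (P.lo_lt_hi k).le
  have hQ' : Continuous fun x => extendFrom (Ioo (P.lo k) (P.hi k)) P.q
      (max (P.lo k) (min (P.hi k) x)) :=
    hQ.comp_continuous (by fun_prop) (LinearODE.clamp_mem hab)
  refine ⟨fun x => (((P.ρ k ^ 2 : ℝ) : ℂ))⁻¹ * ((extendFrom (Ioo (P.lo k) (P.hi k)) P.q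
      (max (P.lo k) (min (P.hi k) x)) : ℝ) - z), by fun_prop, fun x hx => ?_⟩
  have hρ : ((P.ρ k ^ 2 : ℝ) : ℂ) ≠ 0 := by
    exact_mod_cast pow_ne_zero 2 (P.ρ_ne_zero k)
  rw [mul_inv_cancel_left₀ hρ, LinearODE.clamp_of_mem (Ioo_subset_Icc_self hx),
    show extendFrom (Ioo (P.lo k) (P.hi k)) P.q x = P.q x from
      extendFrom_extends (P.q_continuousOn k) x hx]

variable {P}

theorem ACloc.of_eq_integral {k : Fin (n + 1)} {f h : ℝ → ℂ} {y : ℂ}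
    (hh : IntegrableOn h (P.Ω k))
    (hf : ∀ x ∈ Icc (P.lo k) (P.hi k), f x = y + ∫ t in P.lo k..x, h t) : P.ACloc k f := by
  refine ACloc.congr (g := fun x => y + ∫ t in P.lo k..x, h t) (fun s t hst hsub => ?_)
    fun x hx => (hf x (Ioo_subset_Icc_self hx)).symm
  have hab := (P.lo_lt_hi k).le
  have hI : IntervalIntegrable h volume (P.lo k) (P.hi k) :=
    LinearODE.intervalIntegrable_of_Ioo hh (right_mem_Icc.2 hab)
  have h1 := LinearODE.absolutelyContinuousOnInterval_integral hI left_mem_uIcc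
  have h2 : AbsolutelyContinuousOnInterval (fun _ : ℝ => y) (P.lo k) (P.hi k) :=
    contDiff_const.contDiffOn.absolutelyContinuousOnInterval
  refine (h2.add h1).mono ?_
  rw [uIcc_of_le hst, uIcc_of_le hab]
  exact hsub.trans Ioo_subset_Icc_self

/-- Lebesgue differentiation. It serves for `u'`, whose derivative involves the merely square
integrable `g`. -/
theorem ae_hasDerivAt_of_eq_integral {k : Fin (n + 1)} {f h : ℝ → ℂ} {y : ℂ}
    (hh : IntegrableOn h (P.Ω k))
    (hf : ∀ x ∈ Icc (P.lo k) (P.hi k), f x = y + ∫ t in P.lo k..x, h t) :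
    ∀ᵐ x ∂volume.restrict (P.Ω k), HasDerivAt f (h x) x := by
  have hab := (P.lo_lt_hi k).le
  have hI : IntervalIntegrable h volume (P.lo k) (P.hi k) :=
    LinearODE.intervalIntegrable_of_Ioo hh (right_mem_Icc.2 hab)
  filter_upwards [ae_restrict_of_ae hI.ae_hasDerivAt_integral,
    ae_restrict_mem (measurableSet_Ioo : MeasurableSet (P.Ω k))] with x hx hxk
  have hxk' : x ∈ Icc (P.lo k) (P.hi k) := Ioo_subset_Icc_self hxk
  rw [uIcc_of_le hab] at hx
  refine ((hx hxk' _ (left_mem_Icc.2 hab)).const_add y).congr_of_eventuallyEq ?_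
  filter_upwards [isOpen_Ioo.mem_nhds hxk] with t ht using hf t (Ioo_subset_Icc_self ht)

/-- With a continuous integrand the derivative exists at every point. It serves for `u` itself,
since `Admissible` asks for differentiability everywhere on the interval. -/
theorem hasDerivAt_of_eq_integral {k : Fin (n + 1)} {f : ℝ → ℂ} {h : ℝ →ᵇ ℂ} {y : ℂ}
    (hf : ∀ x ∈ Icc (P.lo k) (P.hi k), f x = y + ∫ t in P.lo k..x, h t) {x : ℝ} (hx : x ∈ P.Ω k) :
    HasDerivAt f (h x) x := by
  refine ((intervalIntegral.integral_hasDerivAt_right (a := P.lo k) (h.continuous.intervalIntegrable _ _)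
    h.continuous.stronglyMeasurable.stronglyMeasurableAtFilter
    h.continuous.continuousAt).const_add y).congr_of_eventuallyEq ?_
  filter_upwards [isOpen_Ioo.mem_nhds hx] with t ht using hf t (Ioo_subset_Icc_self ht)

/-- `u` solves `z u - ℓ u = g` on interval number `k`, and `v` is its derivative. -/
structure SolvesOn (P : Problem n) (z : ℂ) (k : Fin (n + 1)) (u v : ℝ →ᵇ ℂ) (g : ℝ → ℂ) :
    Prop where
  hasDerivAt : ∀ x ∈ P.Ω k, HasDerivAt u (v x) x
  ac : P.ACloc k u
  ac_deriv : P.ACloc k v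
  eq : ∀ᵐ x ∂volume.restrict (P.Ω k),
    -((P.ρ k ^ 2 : ℝ) : ℂ) * deriv v x + (P.q x : ℂ) * u x = z * u x - g x

theorem exists_solvesOn (P : Problem n) (z : ℂ) (k : Fin (n + 1)) :
    ∃ U V : (ℂ × ℂ) × Lp ℂ 2 (volume.restrict (P.Ω k)) →L[ℂ] (ℝ →ᵇ ℂ), ∀ w,
      P.SolvesOn z k (U w) (V w) (w.2) ∧ U w (P.lo k) = w.1.1 ∧ V w (P.lo k) = w.1.2 := by
  obtain ⟨c, hc, hcq⟩ := P.exists_continuous_potential z k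
  have hab := (P.lo_lt_hi k).le
  have hρ : ((P.ρ k ^ 2 : ℝ) : ℂ) ≠ 0 := by
    exact_mod_cast pow_ne_zero 2 (P.ρ_ne_zero k)
  obtain ⟨U, V, h⟩ : ∃ U V : (ℂ × ℂ) × Lp ℂ 2 (volume.restrict (P.Ω k)) →L[ℂ] (ℝ →ᵇ ℂ),
      ∀ w, ∀ x ∈ Icc (P.lo k) (P.hi k),
        U w x = w.1.1 + (∫ t in P.lo k..x, V w t) ∧
        V w x = w.1.2 + ∫ t in P.lo k..x, (c t * U w t + w.2 t) :=
    LinearODE.exists_second_order_solution hab hc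
  -- Since `z u - ℓ u = g` means `u'' = ((q - z) / ρ²) u + g / ρ²`, the forcing is first divided by
  -- `ρ²`.
  let r : (ℂ × ℂ) × Lp ℂ 2 (volume.restrict (P.Ω k)) →L[ℂ]
      (ℂ × ℂ) × Lp ℂ 2 (volume.restrict (P.Ω k)) :=
    (ContinuousLinearMap.id ℂ _).prodMap ((((P.ρ k ^ 2 : ℝ) : ℂ))⁻¹ • ContinuousLinearMap.id ℂ _)
  refine ⟨U ∘L r, V ∘L r, fun w => ?_⟩
  have hU := fun x hx => (h (r w) x hx).1
  have hV := fun x hx => (h (r w) x hx).2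
  have hVi : IntegrableOn (V (r w)) (P.Ω k) :=
    ((V (r w)).continuous.continuousOn.integrableOn_Icc).mono_set Ioo_subset_Icc_self
  have hUi : IntegrableOn (fun t => c t * U (r w) t + (r w).2 t) (P.Ω k) :=
    (((hc.mul (U (r w)).continuous).continuousOn.integrableOn_Icc).mono_set
      Ioo_subset_Icc_self).add ((Lp.memLp (r w).2).integrable (by norm_num))
  refine ⟨⟨fun x hx => hasDerivAt_of_eq_integral hU hx, ACloc.of_eq_integral hVi hU,
    ACloc.of_eq_integral hUi hV, ?_⟩, ?_, ?_⟩
  · filter_upwards [ae_hasDerivAt_of_eq_integral hUi hV,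
      ae_restrict_mem (measurableSet_Ioo : MeasurableSet (P.Ω k)),
      Lp.coeFn_smul (((P.ρ k ^ 2 : ℝ) : ℂ))⁻¹ w.2] with x hx hxk hs
    have hs' : (r w).2 x = (((P.ρ k ^ 2 : ℝ) : ℂ))⁻¹ * w.2 x := hs
    change -((P.ρ k ^ 2 : ℝ) : ℂ) * deriv (V (r w)) x + (P.q x : ℂ) * U (r w) x =
      z * U (r w) x - w.2 x
    rw [hx.deriv, hs', neg_mul, mul_add, ← mul_assoc, hcq x hxk, mul_inv_cancel_left₀ hρ]
    ring
  · exact (hU _ (left_mem_Icc.2 hab)).trans (by rw [intervalIntegral.integral_same, add_zero]; rfl)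
  · exact (hV _ (left_mem_Icc.2 hab)).trans (by rw [intervalIntegral.integral_same, add_zero]; rfl)

/-! ### Passing the nodes and gluing the solutions -/

/-- For given left-hand limits `y = (u, u')` the transmission conditions are a 2×2 system for the
right-hand ones, with determinant `θ i 0 1 > 0`; `T` is Cramer's rule. -/
theorem exists_transfer (P : Problem n) (i : Fin n) : ∃ T : ℂ × ℂ →L[ℂ] ℂ × ℂ, ∀ y,
    (P.δm i 1 : ℂ) * y.2 + P.δm i 0 * y.1 + P.δp i 1 * (T y).2 + P.δp i 0 * (T y).1 = 0 ∧
    (P.γm i 1 : ℂ) * y.2 + P.γm i 0 * y.1 + P.γp i 1 * (T y).2 + P.γp i 0 * (T y).1 = 0 := by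
  have hθ : P.θ i 0 1 = P.δp i 1 * P.γp i 0 - P.δp i 0 * P.γp i 1 := by
    simp [Coeffs.θ, Coeffs.transMatrix, Matrix.det_fin_two]
  have hd : (P.δp i 1 * P.γp i 0 - P.δp i 0 * P.γp i 1 : ℂ) ≠ 0 := by
    have h := (P.θ_pos i 0 1 (by decide)).ne'
    rw [hθ] at h
    exact_mod_cast h
  let L : ℂ × ℂ →ₗ[ℂ] ℂ × ℂ :=
    { toFun := fun y =>
        ((P.γp i 1 * (P.δm i 1 * y.2 + P.δm i 0 * y.1) -
            P.δp i 1 * (P.γm i 1 * y.2 + P.γm i 0 * y.1)) /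
            (P.δp i 1 * P.γp i 0 - P.δp i 0 * P.γp i 1),
          (P.δp i 0 * (P.γm i 1 * y.2 + P.γm i 0 * y.1) -
            P.γp i 0 * (P.δm i 1 * y.2 + P.δm i 0 * y.1)) /
            (P.δp i 1 * P.γp i 0 - P.δp i 0 * P.γp i 1))
      map_add' := fun x y => by
        refine Prod.ext ?_ ?_ <;> simp only [Prod.fst_add, Prod.snd_add] <;> ring
      map_smul' := fun r y => by
        refine Prod.ext ?_ ?_ <;>
          simp only [Prod.smul_fst, Prod.smul_snd, smul_eq_mul, RingHom.id_apply] <;> ring }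
  refine ⟨L.toContinuousLinearMap, fun y => ?_⟩
  constructor
  · change (P.δm i 1 : ℂ) * y.2 + P.δm i 0 * y.1 + P.δp i 1 * (_ / _) + P.δp i 0 * (_ / _) = 0
    field_simp
    ring
  · change (P.γm i 1 : ℂ) * y.2 + P.γm i 0 * y.1 + P.γp i 1 * (_ / _) + P.γp i 0 * (_ / _) = 0
    linear_combination -(P.γm i 1 * y.2 + P.γm i 0 * y.1) * mul_inv_cancel₀ hd

/-- `u` solves `z u - ℓ u = g` on all intervals and satisfies the transmission conditions, and `v`
is its derivative. -/
structure Solves (P : Problem n) (z : ℂ) (u v : Fin (n + 1) → ℝ →ᵇ ℂ)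
    (g : Fin (n + 1) → ℝ → ℂ) : Prop where
  solvesOn : ∀ k, P.SolvesOn z k (u k) (v k) (g k)
  trans_δ : ∀ i : Fin n, (P.δm i 1 : ℂ) * v i.castSucc (P.hi i.castSucc) +
    P.δm i 0 * u i.castSucc (P.hi i.castSucc) + P.δp i 1 * v i.succ (P.lo i.succ) +
    P.δp i 0 * u i.succ (P.lo i.succ) = 0
  trans_γ : ∀ i : Fin n, (P.γm i 1 : ℂ) * v i.castSucc (P.hi i.castSucc) +
    P.γm i 0 * u i.castSucc (P.hi i.castSucc) + P.γp i 1 * v i.succ (P.lo i.succ) +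
    P.γp i 0 * u i.succ (P.lo i.succ) = 0

/-- Solutions are continued from left to right, the end values on one interval determining the
initial values on the next. Every step is bounded and linear, hence so is the whole. -/
theorem exists_solves (P : Problem n) (z : ℂ) :
    ∃ U V : Fin (n + 1) →
        (ℂ × ℂ) × (∀ k, Lp ℂ 2 (volume.restrict (P.Ω k))) →L[ℂ] (ℝ →ᵇ ℂ),
      ∀ w, P.Solves z (fun k => U k w) (fun k => V k w) (fun k => w.2 k) ∧
        U 0 w (P.lo 0) = w.1.1 ∧ V 0 w (P.lo 0) = w.1.2 := by
  choose U V h using P.exists_solvesOn z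
  choose T hT using P.exists_transfer
  let X := (ℂ × ℂ) × (∀ k, Lp ℂ 2 (volume.restrict (P.Ω k)))
  let pr : ∀ k, X →L[ℂ] Lp ℂ 2 (volume.restrict (P.Ω k)) := fun k =>
    ContinuousLinearMap.proj k ∘L ContinuousLinearMap.snd ℂ _ _
  -- `I k` sends the data `(y, g)` to the initial values on interval `k`: `y` itself for `k = 0`,
  -- then the transfer of the end values on the preceding interval.
  let I : Fin (n + 1) → X →L[ℂ] ℂ × ℂ := fun k =>
    Fin.induction (motive := fun _ => X →L[ℂ] ℂ × ℂ) (ContinuousLinearMap.fst ℂ _ _)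
      (fun i J => T i ∘L
        ((BoundedContinuousFunction.evalCLM ℂ (P.hi i.castSucc) ∘L U i.castSucc).prod
          (BoundedContinuousFunction.evalCLM ℂ (P.hi i.castSucc) ∘L V i.castSucc)) ∘L
        (J.prod (pr i.castSucc))) k
  have I0 : I 0 = ContinuousLinearMap.fst ℂ _ _ := rfl
  have Is : ∀ (i : Fin n) (w : X), I i.succ w =
      T i (U i.castSucc (I i.castSucc w, w.2 i.castSucc) (P.hi i.castSucc),
        V i.castSucc (I i.castSucc w, w.2 i.castSucc) (P.hi i.castSucc)) := fun i w => rfl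
  refine ⟨fun k => U k ∘L (I k).prod (pr k), fun k => V k ∘L (I k).prod (pr k), fun w =>
    ⟨⟨fun k => (h k (I k w, w.2 k)).1, fun i => ?_, fun i => ?_⟩,
      (h 0 (I 0 w, w.2 0)).2.1, (h 0 (I 0 w, w.2 0)).2.2⟩⟩
  · have h1 := (h i.succ (I i.succ w, w.2 i.succ)).2
    have h2 := (hT i (U i.castSucc (I i.castSucc w, w.2 i.castSucc) (P.hi i.castSucc),
      V i.castSucc (I i.castSucc w, w.2 i.castSucc) (P.hi i.castSucc))).1
    rw [← Is, ← h1.1, ← h1.2] at h2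
    exact h2
  · have h1 := (h i.succ (I i.succ w, w.2 i.succ)).2
    have h2 := (hT i (U i.castSucc (I i.castSucc w, w.2 i.castSucc) (P.hi i.castSucc),
      V i.castSucc (I i.castSucc w, w.2 i.castSucc) (P.hi i.castSucc))).2
    rw [← Is, ← h1.1, ← h1.2] at h2
    exact h2

/-! ### Glued solutions are admissible -/

theorem limLo_bcf (k : Fin (n + 1)) (u : ℝ →ᵇ ℂ) : P.limLo k u = u (P.lo k) :=
  limLo_eq (u.continuous.continuousAt.tendsto.mono_left nhdsWithin_le_nhds)

theorem limHi_bcf (k : Fin (n + 1)) (u : ℝ →ᵇ ℂ) : P.limHi k u = u (P.hi k) :=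
  limHi_eq (u.continuous.continuousAt.tendsto.mono_left nhdsWithin_le_nhds)

section solves

variable {z : ℂ} {u v : Fin (n + 1) → ℝ →ᵇ ℂ} {g : Fin (n + 1) → ℝ → ℂ}

theorem Solves.deriv_eqOn (h : P.Solves z u v g) (k : Fin (n + 1)) :
    EqOn (deriv (u k)) (v k) (P.Ω k) := fun x hx => ((h.solvesOn k).hasDerivAt x hx).deriv

theorem Solves.limLo_deriv (h : P.Solves z u v g) (k : Fin (n + 1)) :
    P.limLo k (deriv (u k)) = v k (P.lo k) := by
  rw [limLo_congr (h.deriv_eqOn k), limLo_bcf]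

theorem Solves.limHi_deriv (h : P.Solves z u v g) (k : Fin (n + 1)) :
    P.limHi k (deriv (u k)) = v k (P.hi k) := by
  rw [limHi_congr (h.deriv_eqOn k), limHi_bcf]

theorem Solves.ell_ae_eq (h : P.Solves z u v g) (k : Fin (n + 1)) :
    P.ell (fun k => u k) k =ᵐ[volume.restrict (P.Ω k)] fun x => z * u k x - g k x := by
  filter_upwards [(h.solvesOn k).eq,
    ae_restrict_mem (measurableSet_Ioo : MeasurableSet (P.Ω k))] with x hx hxk
  rw [← hx, ell, SturmTransmission.Problem.deriv_eqOn (h.deriv_eqOn k) hxk]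

theorem Solves.admissible (h : P.Solves z u v g)
    (hg : ∀ k, MemLp (g k) 2 (volume.restrict (P.Ω k))) : P.Admissible (fun k => u k) where
  diff k x hx := ((h.solvesOn k).hasDerivAt x hx).differentiableAt.differentiableWithinAt
  ac k := (h.solvesOn k).ac
  ac_deriv k := (h.solvesOn k).ac_deriv.congr (h.deriv_eqOn k).symm
  lo k := ⟨_, (u k).continuous.continuousAt.tendsto.mono_left nhdsWithin_le_nhds⟩
  hi k := ⟨_, (u k).continuous.continuousAt.tendsto.mono_left nhdsWithin_le_nhds⟩
  lo_deriv k := ⟨_, ((v k).continuous.continuousAt.tendsto.mono_left nhdsWithin_le_nhds).congr'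
    ((h.deriv_eqOn k).symm.eventuallyEq_of_mem (P.Ω_mem_lo k))⟩
  hi_deriv k := ⟨_, ((v k).continuous.continuousAt.tendsto.mono_left nhdsWithin_le_nhds).congr'
    ((h.deriv_eqOn k).symm.eventuallyEq_of_mem (P.Ω_mem_hi k))⟩
  memLp k := by
    -- A bounded function on a bounded interval is square integrable, hence so is `ℓ u = z u - g`.
    have hu : MemLp (fun x => u k x) 2 (volume.restrict (P.Ω k)) :=
      (u k).memLp_top.mono_exponent le_top
    exact ((hu.const_mul z).sub (hg k)).ae_eq (h.ell_ae_eq k).symm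
  trans_δ i := by
    simp only [trans, h.limLo_deriv, h.limHi_deriv, limLo_bcf, limHi_bcf]
    exact h.trans_δ i
  trans_γ i := by
    simp only [trans, h.limLo_deriv, h.limHi_deriv, limLo_bcf, limHi_bcf]
    exact h.trans_γ i

end solves

/-! ### The topology of the Hilbert space -/

theorem norm_sq_eq (F : P.Space) : ‖F‖ ^ 2 =
    (∑ k, P.weight k * ‖F.1 k‖ ^ 2) + P.weight₁ * ‖F.2.1‖ ^ 2 + P.weight₂ * ‖F.2.2‖ ^ 2 := by
  have h : ((‖F‖ ^ 2 : ℝ) : ℂ) = P.innerProd F F := by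
    rw [Complex.ofReal_pow]
    exact (inner_self_eq_norm_sq_to_K (𝕜 := ℂ) F).symm
  rw [innerProd_self] at h
  exact_mod_cast h

theorem weight_mul_norm_sq_nonneg (F : P.Space) (k : Fin (n + 1)) :
    0 ≤ P.weight k * ‖F.1 k‖ ^ 2 :=
  mul_nonneg (P.weight_pos k).le (sq_nonneg _)

theorem norm_le_of_mul_sq_le {w x y : ℝ} (hw : 0 < w) (hy : 0 ≤ y) (h : w * x ^ 2 ≤ y ^ 2) :
    x ≤ √w⁻¹ * y := by
  refine le_of_sq_le_sq ?_ (by positivity)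
  rw [mul_pow, Real.sq_sqrt (by positivity), inv_mul_eq_div, le_div_iff₀ hw]
  linarith

theorem norm_fn_le (F : P.Space) (k : Fin (n + 1)) : ‖F.1 k‖ ≤ √(P.weight k)⁻¹ * ‖F‖ := by
  refine norm_le_of_mul_sq_le (P.weight_pos k) (norm_nonneg _) ?_
  have h1 := Finset.single_le_sum (fun k _ => weight_mul_norm_sq_nonneg F k) (Finset.mem_univ k)
  have h2 := mul_nonneg P.weight₁_pos.le (sq_nonneg ‖F.2.1‖)
  have h3 := mul_nonneg P.weight₂_pos.le (sq_nonneg ‖F.2.2‖)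
  rw [norm_sq_eq]
  linarith

theorem norm_fst_le (F : P.Space) : ‖F.2.1‖ ≤ √(P.weight₁)⁻¹ * ‖F‖ := by
  refine norm_le_of_mul_sq_le P.weight₁_pos (norm_nonneg _) ?_
  have h1 := Finset.sum_nonneg fun k (_ : k ∈ Finset.univ) => weight_mul_norm_sq_nonneg F k
  have h3 := mul_nonneg P.weight₂_pos.le (sq_nonneg ‖F.2.2‖)
  rw [norm_sq_eq]
  linarith

theorem norm_snd_le (F : P.Space) : ‖F.2.2‖ ≤ √(P.weight₂)⁻¹ * ‖F‖ := by
  refine norm_le_of_mul_sq_le P.weight₂_pos (norm_nonneg _) ?_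
  have h1 := Finset.sum_nonneg fun k (_ : k ∈ Finset.univ) => weight_mul_norm_sq_nonneg F k
  have h3 := mul_nonneg P.weight₁_pos.le (sq_nonneg ‖F.2.1‖)
  rw [norm_sq_eq]
  linarith

/-- The identity, as an isomorphism from the Hilbert space to the product of its components with
the sup norm. -/
def components (P : Problem n) :
    P.Space ≃L[ℂ] (∀ k : Fin (n + 1), Lp ℂ 2 (volume.restrict (P.Ω k))) × ℂ × ℂ :=
  LinearEquiv.toContinuousLinearEquivOfBounds
    { toFun := fun F => F
      invFun := fun F => F
      map_add' := fun _ _ => rfl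
      map_smul' := fun _ _ => rfl
      left_inv := fun _ => rfl
      right_inv := fun _ => rfl }
    -- The first constant dominates the bound for each separate component. The second arises by
    -- replacing every component in the weighted sum of squares by the sup norm.
    ((∑ k, √(P.weight k)⁻¹) + √(P.weight₁)⁻¹ + √(P.weight₂)⁻¹)
    √((∑ k, P.weight k) + P.weight₁ + P.weight₂)
    (fun F => by
      have h0 : 0 ≤ ∑ k, √(P.weight k)⁻¹ := Finset.sum_nonneg fun _ _ => Real.sqrt_nonneg _
      have h1 := Real.sqrt_nonneg (P.weight₁)⁻¹
      have h2 := Real.sqrt_nonneg (P.weight₂)⁻¹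
      have hF := norm_nonneg F
      refine (Prod.norm_def _).trans_le (max_le ?_ ((Prod.norm_def _).trans_le (max_le ?_ ?_)))
      · refine (pi_norm_le_iff_of_nonneg (by positivity)).2 fun k => (norm_fn_le F k).trans ?_
        have h3 := Finset.single_le_sum (fun k _ => Real.sqrt_nonneg (P.weight k)⁻¹)
          (Finset.mem_univ k)
        gcongr
        linarith
      · refine (norm_fst_le F).trans ?_
        gcongr
        linarith
      · refine (norm_snd_le F).trans ?_
        gcongr
        linarith)
    (fun F => by
      have p1 := P.weight₁_pos
      have p2 := P.weight₂_pos
      have p0 : 0 ≤ ∑ k, P.weight k := Finset.sum_nonneg fun k _ => (P.weight_pos k).le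
      refine le_of_sq_le_sq ?_ (by positivity)
      rw [mul_pow, Real.sq_sqrt (by positivity)]
      refine (norm_sq_eq (P := P) F).trans_le ?_
      rw [add_mul, add_mul, Finset.sum_mul]
      gcongr with k
      · exact (P.weight_pos k).le
      · exact (norm_le_pi_norm F.1 k).trans (_root_.norm_fst_le F)
      · exact (_root_.norm_fst_le F.2).trans (_root_.norm_snd_le F)
      · exact (_root_.norm_snd_le F.2).trans (_root_.norm_snd_le F))

end SturmTransmission.Problem

/-! ### Eigenvalues and one-sided inverses of an unbounded operator -/

namespace UnboundedOperator

variable {E : Type*} [NormedAddCommGroup E] [NormedSpace ℂ E]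

/-- A left inverse of `z - T` would send `(z - T) x = 0` back to the eigenvector `x`. -/
theorem pointSpectrum_subset_spectrum (T : E →ₗ.[ℂ] E) : pointSpectrum T ⊆ spectrum T := by
  rintro z ⟨x, hx0, hx⟩ ⟨S, -, hS⟩
  have h := hS x
  rw [hx, sub_self, map_zero] at h
  exact hx0 h.symm

/-- If `z - T` is injective, then a bounded right inverse of `z - T` is a two-sided inverse. -/
theorem mem_resolventSet_of_rightInverse {T : E →ₗ.[ℂ] E} {z : ℂ} (hz : z ∉ pointSpectrum T)
    (S : E →L[ℂ] E) (hS : ∀ y : E, ∃ h : S y ∈ T.domain, z • S y - T ⟨S y, h⟩ = y) :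
    z ∈ resolventSet T := by
  refine ⟨S, hS, fun x => ?_⟩
  obtain ⟨h, hy⟩ := hS (z • (x : E) - T x)
  by_contra hne
  -- The difference `S ((z - T) x) - x` lies in the kernel of `z - T`, so if nonzero it would be an
  -- eigenvector.
  refine hz ⟨⟨S (z • (x : E) - T x), h⟩ - x, sub_ne_zero.2 hne, ?_⟩
  rw [LinearPMap.map_sub, AddSubgroupClass.coe_sub, smul_sub]
  rw [sub_eq_iff_eq_add] at hy
  rw [hy]
  abel

end UnboundedOperator

/-! ### Construction of the resolvent -/

namespace SturmTransmission.Problem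

variable {n : ℕ} {P : Problem n}

section

variable {z : ℂ} {u v : Fin (n + 1) → ℝ →ᵇ ℂ} {g : ∀ k, Lp ℂ 2 (volume.restrict (P.Ω k))}

theorem Solves.admissible_Lp (h : P.Solves z u v (fun k => g k)) :
    P.Admissible (fun k => u k) :=
  h.admissible fun k => Lp.memLp (g k)

/-- The element `(u, B'ₐ[u], -B'_b[u])`. -/
def element (P : Problem n) (u : Fin (n + 1) → ℝ →ᵇ ℂ) : P.Space :=
  (fun k => BoundedContinuousFunction.toLp 2 _ ℂ (u k), P.Ba' (fun k => u k),
    -P.Bb' (fun k => u k))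

theorem Solves.represents (h : P.Solves z u v (fun k => g k)) :
    P.Represents (fun k => u k) (P.element u) where
  adm := h.admissible_Lp
  fn _ := BoundedContinuousFunction.coeFn_toLp _ _ _ _
  fst := rfl
  snd := rfl

theorem space_ext {F G : P.Space} (h₀ : ∀ k, F.1 k = G.1 k) (h₁ : F.2.1 = G.2.1)
    (h₂ : F.2.2 = G.2.2) : F = G :=
  Prod.ext (funext h₀) (Prod.ext h₁ h₂)

theorem smul_sub_fn (z : ℂ) (F G : P.Space) (k : Fin (n + 1)) :
    (z • F - G).1 k = z • F.1 k - G.1 k := rfl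

theorem smul_sub_fst (z : ℂ) (F G : P.Space) : (z • F - G).2.1 = z * F.2.1 - G.2.1 := rfl

theorem smul_sub_snd (z : ℂ) (F G : P.Space) : (z • F - G).2.2 = z * F.2.2 - G.2.2 := rfl

/-- The differential equation already settles the function components, so solving the resolvent
equation comes down to prescribing the two scalar ones. The sign in the last one stems from the
component `-B'_b[u]`. -/
theorem Solves.smul_sub_operator (h : P.Solves z u v (fun k => g k)) :
    z • P.element u - P.operator ⟨P.element u, _, h.represents⟩ =
      ((g, z * P.Ba' (fun k => u k) - P.Ba (fun k => u k),
        -(z * P.Bb' (fun k => u k)) - P.Bb (fun k => u k)) : P.Space) := by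
  rw [P.operator_apply h.represents]
  refine space_ext (fun k => ?_) ?_ ?_
  · rw [smul_sub_fn]
    refine Lp.ext ?_
    change ⇑(z • (P.element u).1 k - (h.admissible_Lp.memLp k).toLp _) =ᵐ[_] g k
    filter_upwards [Lp.coeFn_sub (z • (P.element u).1 k) ((h.admissible_Lp.memLp k).toLp _),
      Lp.coeFn_smul z ((P.element u).1 k), h.represents.fn k,
      (h.admissible_Lp.memLp k).coeFn_toLp, h.ell_ae_eq k] with x h1 h2 h3 h4 h5
    rw [h1, Pi.sub_apply, h2, h4, h5, Pi.smul_apply, h3, smul_eq_mul]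
    ring
  · rw [smul_sub_fst]
    rfl
  · rw [smul_sub_snd]
    change z * -P.Bb' (fun k => u k) - P.Bb (fun k => u k) = _
    rw [mul_neg]

/-- The only solution of the homogeneous problem has vanishing initial values, if `z` is not an
eigenvalue. -/
theorem Solves.initial_eq_zero (h : P.Solves z u v (fun k => g k))
    (hz : z ∉ UnboundedOperator.pointSpectrum P.operator) (hg : g = 0)
    (ha : z * P.Ba' (fun k => u k) - P.Ba (fun k => u k) = 0)
    (hb : -(z * P.Bb' (fun k => u k)) - P.Bb (fun k => u k) = 0) :
    u 0 (P.lo 0) = 0 ∧ v 0 (P.lo 0) = 0 := by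
  have h0 : P.element u = 0 := by
    by_contra hne
    refine hz ⟨⟨P.element u, _, h.represents⟩, hne, ?_⟩
    have h1 := h.smul_sub_operator.trans (by rw [ha, hb, hg]; rfl : _ = (0 : P.Space))
    exact (sub_eq_zero.1 h1).symm
  have hrep := h.represents
  rw [h0] at hrep
  -- The zero element is also represented by the zero function, so uniqueness of the representative
  -- makes `u` vanish on the first interval; the initial values are limits from there.
  have e : EqOn (u 0) (fun _ => 0) (P.Ω 0) := hrep.eqOn represents_zero 0
  constructor
  · rw [← limLo_bcf, limLo_congr e]
    exact limLo_eq tendsto_const_nhds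
  · rw [← h.limLo_deriv, limLo_congr (SturmTransmission.Problem.deriv_eqOn e)]
    simp only [deriv_const']
    exact limLo_eq tendsto_const_nhds

end

/-- A shooting argument: the initial values at `a` are chosen so that the solution meets the
prescribed data in `ℂ²`. -/
theorem mem_resolventSet_of_notMem_pointSpectrum {z : ℂ}
    (hz : z ∉ UnboundedOperator.pointSpectrum P.operator) :
    z ∈ UnboundedOperator.resolventSet P.operator := by
  obtain ⟨U, V, h⟩ := P.exists_solves z
  let X := (ℂ × ℂ) × (∀ k, Lp ℂ 2 (volume.restrict (P.Ω k)))
  let ev : (X →L[ℂ] (ℝ →ᵇ ℂ)) → ℝ → X →L[ℂ] ℂ := fun W x =>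
    BoundedContinuousFunction.evalCLM ℂ x ∘L W
  let lo := P.lo 0
  let hi := P.hi (Fin.last n)
  let ba : X →L[ℂ] ℂ := (P.δ₁ : ℂ) • ev (U 0) lo - (P.δ₂ : ℂ) • ev (V 0) lo
  let ba' : X →L[ℂ] ℂ := (P.δ₃ : ℂ) • ev (U 0) lo - (P.δ₄ : ℂ) • ev (V 0) lo
  let bb : X →L[ℂ] ℂ :=
    (P.γ₁ : ℂ) • ev (U (Fin.last n)) hi - (P.γ₂ : ℂ) • ev (V (Fin.last n)) hi
  let bb' : X →L[ℂ] ℂ :=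
    (P.γ₃ : ℂ) • ev (U (Fin.last n)) hi - (P.γ₄ : ℂ) • ev (V (Fin.last n)) hi
  have hba : ∀ w, P.Ba (fun k => U k w) = ba w := fun w => by
    rw [Ba, limLo_bcf, (h w).1.limLo_deriv]; rfl
  have hba' : ∀ w, P.Ba' (fun k => U k w) = ba' w := fun w => by
    rw [Ba', limLo_bcf, (h w).1.limLo_deriv]; rfl
  have hbb : ∀ w, P.Bb (fun k => U k w) = bb w := fun w => by
    rw [Bb, limHi_bcf, (h w).1.limHi_deriv]; rfl
  have hbb' : ∀ w, P.Bb' (fun k => U k w) = bb' w := fun w => by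
    rw [Bb', limHi_bcf, (h w).1.limHi_deriv]; rfl
  -- `bd` gives the `ℂ²` part of `(z - T) F` for the glued solution, and `M` is its dependence on
  -- the initial values. `M` is an injective endomorphism of a finite-dimensional space, hence
  -- invertible.
  let bd : X →L[ℂ] ℂ × ℂ := (z • ba' - ba).prod (-(z • bb') - bb)
  let M : ℂ × ℂ →L[ℂ] ℂ × ℂ := bd ∘L ContinuousLinearMap.inl ℂ _ _
  have hM : Function.Injective M.toLinearMap := by
    rw [← LinearMap.ker_eq_bot, LinearMap.ker_eq_bot']
    intro y hy
    have hy' : bd (y, 0) = 0 := hy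
    have hs := h (y, 0)
    have h0 := hs.1.initial_eq_zero hz rfl
      (by rw [hba', hba]; exact congrArg Prod.fst hy')
      (by rw [hbb', hbb]; exact congrArg Prod.snd hy')
    exact Prod.ext (hs.2.1.symm.trans h0.1) (hs.2.2.symm.trans h0.2)
  let N : (ℂ × ℂ) ≃L[ℂ] (ℂ × ℂ) :=
    (LinearEquiv.ofInjectiveEndo M.toLinearMap hM).toContinuousLinearEquiv
  let Y := (∀ k : Fin (n + 1), Lp ℂ 2 (volume.restrict (P.Ω k))) × ℂ × ℂ
  let pr : Y →L[ℂ] ∀ k : Fin (n + 1), Lp ℂ 2 (volume.restrict (P.Ω k)) :=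
    ContinuousLinearMap.fst ℂ _ _
  -- By linearity `bd (y, g) = M y + bd (0, g)`, so a prescribed value `t` is attained at `y = M⁻¹
  -- (t - bd (0, g))`.
  let ini : Y →L[ℂ] ℂ × ℂ := (N.symm : ℂ × ℂ →L[ℂ] ℂ × ℂ) ∘L
    (ContinuousLinearMap.snd ℂ _ _ - bd ∘L ContinuousLinearMap.inr ℂ _ _ ∘L pr)
  let W : Y →L[ℂ] X := ini.prod pr
  have hW : ∀ y, bd (W y) = y.2 := fun y => by
    have h1 : M (ini y) = y.2 - bd (0, y.1) := N.apply_symm_apply _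
    have h2 : bd (ini y, 0) = y.2 - bd (0, y.1) := h1
    have h3 : W y = (ini y, 0) + (0, y.1) := Prod.ext (add_zero _).symm (zero_add _).symm
    rw [h3, map_add, h2, sub_add_cancel]
  let Z : X →L[ℂ] Y :=
    (ContinuousLinearMap.pi fun k => BoundedContinuousFunction.toLp 2 _ ℂ ∘L U k).prod
      (ba'.prod (-bb'))
  -- Boundedness was obtained for the sup norm on the components; conjugating with `components`
  -- transfers it to the weighted Hilbert norm.
  let S : P.Space →L[ℂ] P.Space := (P.components.symm : Y →L[ℂ] P.Space) ∘L Z ∘L W ∘L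
    (P.components : P.Space →L[ℂ] Y)
  have hS : ∀ y : P.Space, S y = P.element fun k => U k (W y) := fun y =>
    Prod.ext rfl (Prod.ext (hba' _).symm (congrArg Neg.neg (hbb' _).symm))
  refine UnboundedOperator.mem_resolventSet_of_rightInverse hz S fun y => ?_
  have hs := (h (W y)).1
  rw [hS]
  refine ⟨⟨_, hs.represents⟩, hs.smul_sub_operator.trans ?_⟩
  have h1 : z * ba' (W y) - ba (W y) = y.2.1 := congrArg Prod.fst (hW y)
  have h2 : -(z * bb' (W y)) - bb (W y) = y.2.2 := congrArg Prod.snd (hW y)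
  rw [hba', hba, hbb', hbb, h1, h2]
  rfl

end SturmTransmission.Problem

end

theorem mainTheorem6 {n : ℕ} (P : SturmTransmission.Problem n) :
    UnboundedOperator.spectrum P.operator = UnboundedOperator.pointSpectrum P.operator :=
  Subset.antisymm
    (fun _ hz => by
      by_contra h
      exact hz (SturmTransmission.Problem.mem_resolventSet_of_notMem_pointSpectrum h))
    (UnboundedOperator.pointSpectrum_subset_spectrum _)
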